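/- **Types.** System F types are $T::=\alpha\mid T\to U\mid\forall\alpha.T$. System F terms are in Church style (every variable $x^T$ carries its type): $x^T$, $\lambda x^T.M$, $(M)N$, $\Lambda\alpha.M$, $(M)T$, typed as usual, where in $\Lambda\alpha.M$ the variable $\alpha$ is not free in the types of the free term variables of $M$. The size $|M|$ is the number of symbols of $M$, where each occurrence of a variable $x^T$ counts together with its type $T$, and so do the types at binders and in type applications. Terms and types are taken up to renaming of bound variables. The linear types of $DLAL\star$ are $A::=\alpha\mid D\multimap A\mid\forall\alpha.A\mid\S A$, and its types are $D::=A\mid\,!A$; types $!A$ are called bang types, $(!A)^\circ=\S A$, and $D^\circ=D$ otherwise. **Pseudo-terms.** $t::=x^D\mid\lambda x^D.t\mid(t)t\mid\Lambda\alpha.t\mid(t)A\mid\S t\mid\bar\S t$. A pseudo-term is *regular* if it has no subterm $\S\bar\S u$ or $\bar\S\S u$. For an occurrence $u$ of a subterm of $t$, $t\|u$ is the word of the doors $\S,\bar\S$ on the path from the root of $t$ to $u$; $s(l)$ is the number of $\S$ minus the number of $\bar\S$ in $l$; $l$ is *weakly well-bracketed* if $s(l')\ge0$ for all prefixes $l'$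 of $l$, and *well-bracketed* if moreover $s(l)=0$. A regular pseudo-term $t$ is *well-structured* if the following four conditions hold. * *Local typing.* (i) The following rules assign a linear type to $t$: $x^D:D^\circ$; $\lambda x^D.t:D\multimap B$ if $t:B$; $(t)u:B$ if $t:D\multimap B$ and $u:D^\circ$; $\S t:\S A$ if $t:A$; $\bar\S t:A$ if $t:\S A$; $\Lambda\alpha.t:\forall\alpha.A$ if $t:A$; $(t)B:A[B/\alpha]$ if $t:\forall\alpha.A$. (ii) A variable that occurs more than once has a bang type. (iii) In each subterm $\Lambda\alpha.u$, $\alpha$ is not free in the types of the free term variables of $u$. * *Bracketing.* $t\|x$ is well-bracketed for each occurrence of a free variable $x$; for each abstraction subterm $\lambda x.v$, $t\|\lambda x.v$ is weakly well-bracketed and $v\|x$ is well-bracketed for each occurrence of $x$ in $v$. * *Bang.* For each subterm $u$ that occurs in $t$ as $(t')u$ with $t':\,!A\multimap B$: (i) $u$ has at most one occurrence of a free variable $x$, and $x$ has a bang type; (ii) $u$ is not of the form $\bar\S w$, and $s(u\|v)\ge1$ for each subterm $v$ of $u$ other than $u$ and that free variable. * *$\Lambda$-scope.* For each subterm $\Lambda\alpha.u$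 of $t$ and each subterm $v$ of $u$ whose type has $\alpha$ free, $u\|v$ is weakly well-bracketed. **Parameters.** Let $\mathbf n,\mathbf m$ be integer parameters, $\mathbf b$ boolean parameters and $\mathbf c$ formal sums of integer parameters. *P-types* are $F::=\alpha\mid D\multimap A\mid\forall\alpha.A$, $A::=\S^{\mathbf c}F$ (linear), $D::=\S^{\mathbf b,\mathbf c}F$ (bang); put $(\S^{\mathbf b,\mathbf c}F)^\circ=\S^{\mathbf c}F$. $B[\S^{\mathbf c}F/\alpha]$ replaces $\S^{\mathbf c'}\alpha$ by $\S^{\mathbf c'+\mathbf c}F$ and $\S^{\mathbf b,\mathbf c'}\alpha$ by $\S^{\mathbf b,\mathbf c'+\mathbf c}F$. *P-terms* are $u::=x^D\mid\lambda x^D.t\mid(t)t\mid\Lambda\alpha.t\mid(t)A$, $t::=\S^{\mathbf m}u$. A *free decoration* $\widetilde M$ of $M$ is obtained by decorating the type of each variable to a bang p-type and the argument of each type application to a linear p-type, with a single integer parameter at each place, and putting $\S^{\mathbf m}$ above each node of $M$ (variables included), all parameters being mutually distinct (all occurrences of a variable share its p-type). An *instantiation* $\phi$ gives values in $\{0,1\}$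 to the boolean and in $\mathbb Z$ to the integer parameters, and hence in $\mathbb Z$ to sums $\mathbf c$. It is *admissible* for $\widetilde M$ if in all p-types that occur in $\widetilde M$ (as types of variables or arguments of type applications) $\phi(\mathbf c)\ge0$ for each $\mathbf c$, and $\phi(\mathbf b)=1$ implies $\phi(\mathbf c)\ge1$ for each $\S^{\mathbf b,\mathbf c}F$. Then $\phi(\widetilde M)$ is the pseudo-term obtained by $\phi(\S^{\mathbf c}F)=\S^{\phi(\mathbf c)}\phi(F)$, $\phi(\S^{\mathbf b,\mathbf c}F)=\S^{\phi(\mathbf c)}\phi(F)$ if $\phi(\mathbf b)=0$ and $!\S^{\phi(\mathbf c)-1}\phi(F)$ if $\phi(\mathbf b)=1$, and $\phi(\S^{\mathbf m}u)=\S^{\phi(\mathbf m)}\phi(u)$, where $\S^{-n}$ stands for $n$ doors $\bar\S$. **Constraints.** $\mathcal U(E_1,E_2)$, for p-types with the same underlying system F type, is the set of the equations $\mathbf c_1=\mathbf c_2$ and $\mathbf b_1=\mathbf b_2$ between the parameters at corresponding places. $\mathsf{Adm}(E)$ consists of $\mathbf c\ge0$ for each $\mathbf c$ in $E$ and $\mathbf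 b=1\Rightarrow\mathbf c\ge1$ for each $\S^{\mathbf b,\mathbf c}F$ in $E$. Subterms get a linear p-type and a set of constraints by these rules: $x^D:D^\circ:\mathsf{Adm}(D)$; $\S^{\mathbf m}t:\S^{\mathbf m+\mathbf c}F:\mathcal C\cup\{\mathbf m+\mathbf c\ge0\}$ if $t:\S^{\mathbf c}F:\mathcal C$; $\lambda x^D.t:\S^{0}(D\multimap A):\mathcal C\cup\mathsf{Adm}(D)$ if $t:A:\mathcal C$; $(t)u:B:\mathcal C_1\cup\mathcal C_2\cup\{\mathbf c=0\}\cup\mathcal U(D^\circ,A)$ if $t:\S^{\mathbf c}(D\multimap B):\mathcal C_1$ and $u:A:\mathcal C_2$; $\Lambda\alpha.t:\S^0\forall\alpha.A:\mathcal C$ if $t:A:\mathcal C$; $(t)A:B[A/\alpha]:\mathcal C\cup\{\mathbf c=0\}\cup\mathsf{Adm}(A)$ if $t:\S^{\mathbf c}\forall\alpha.B:\mathcal C$. For p-terms $t\|u$ is the word of the parameters $\mathbf m$ of the doors $\S^{\mathbf m}$ on the path from $t$ to $u$, $s(l)$ is the sum of $l$, $\mathsf{wbracket}(l)=\{s(l')\ge0: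 l'\text{ a prefix of }l\}$, $\mathsf{bracket}(l)=\mathsf{wbracket}(l)\cup\{s(l)=0\}$. Here both $\S^{\mathbf m}u$ and $u$ count as subterms. * $\mathsf{Ltype}(\widetilde M)$: the constraints of $\widetilde M$ by the rules above, and $\mathbf b=1$ for each $x^{\S^{\mathbf b,\mathbf c}F}$ that occurs more than once. * $\mathsf{Bracket}(\widetilde M)$: $\mathsf{bracket}(\widetilde M\|x)$ for each occurrence of a free variable $x$; $\mathsf{wbracket}(\widetilde M\|\lambda x.v)$ for each abstraction subterm $\lambda x.v$, and $\mathsf{bracket}(v\|x)$ for each occurrence of $x$ in $v$. * $\mathsf{Bang}(\widetilde M)$: for each $u$ that occurs as $(t)u$ with $t:\S^{\mathbf c'}(\S^{\mathbf b,\mathbf c}F\multimap B)$: $\mathbf b=0$ if $u$ has more than one occurrence of free variables; $\mathbf b=1\Rightarrow\mathbf b'=1$ if it has exactly one, of a variable $x^{\S^{\mathbf b',\mathbf c''}F'}$; $\mathbf b=1\Rightarrow s(u\|v)\ge1$ for each subterm $v$ of $u$ other than $u$ and the free variable occurrences; and $\mathbf b=1\Rightarrow s(u\|x)=0$ for the free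 variable occurrence $x$ in $u$, if any. * $\mathsf{Scope}(\widetilde M)$: $\mathsf{wbracket}(u\|v)$ for each subterm $\Lambda\alpha.u$ and each subterm $v$ of $u$ whose p-type has $\alpha$ free. Let $\mathsf{Const}(\widetilde M)$ be the union of these four sets. **Theorem.** Let $M$ be a system F term, $\widetilde M$ a free decoration of $M$ and $\phi$ an instantiation for $\widetilde M$. Then $\phi$ is admissible for $\widetilde M$ and $\phi(\widetilde M)$ is well-structured if and only if $\phi$ is a solution of $\mathsf{Const}(\widetilde M)$. Moreover, the number of (in)equations in $\mathsf{Const}(\widetilde M)$ is at most quadratic in the size of $M$: there is a constant $K$ such that $\mathsf{Const}(\widetilde M)$ has at most $K\,|M|^2$ elements, for all $M$ and $\widetilde M$. -/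

import Mathlib

/-! Bound variables are represented by de Bruijn indices, both for type variables and for term
variables, so terms and types are literally identified up to renaming of bound variables.
A term with free variables is considered in a context, the list of the types of its
free variables; going under a type abstraction renames the type variables of the context. -/

namespace DLAL

/-- Lift a renaming of type variables under one type binder. -/
def upRen (ρ : ℕ → ℕ) : ℕ → ℕ
  | 0 => 0
  | n + 1 => ρ n + 1

/-! ### System F -/

/-- System F types `T ::= α | T → U | ∀ α. T`. -/
inductive Ty : Type
  | var (i : ℕ)
  | arr (T U : Ty)
  | all (T : Ty)

namespace Ty

def rename (ρ : ℕ → ℕ) : Ty → Ty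
  | var i => var (ρ i)
  | arr T U => arr (T.rename ρ) (U.rename ρ)
  | all T => all (T.rename (upRen ρ))

/-- Weakening by one type variable. -/
def up (T : Ty) : Ty := T.rename Nat.succ

def upSub (σ : ℕ → Ty) : ℕ → Ty
  | 0 => var 0
  | n + 1 => (σ n).up

/-- Simultaneous capture-avoiding substitution. -/
def subst : (ℕ → Ty) → Ty → Ty
  | σ, var i => σ i
  | σ, arr T U => arr (T.subst σ) (U.subst σ)
  | σ, all T => all (T.subst (upSub σ))

/-- `U.inst T` is `U[T/α]`, where `α` is the variable `0` of `U`. -/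
def inst (U T : Ty) : Ty :=
  U.subst fun
    | 0 => T
    | n + 1 => var n

/-- Number of symbols of a type. -/
def size : Ty → ℕ
  | var _ => 1
  | arr T U => T.size + U.size + 1
  | all T => T.size + 1

end Ty

/-- Raw terms of system F in Church style. -/
inductive FTm : Type
  | var (i : ℕ)
  | lam (T : Ty) (M : FTm)
  | app (M N : FTm)
  | tlam (M : FTm)
  | tapp (M : FTm) (T : Ty)

namespace FTm

/-- `HasTy Γ M T`: `M` is a term of system F of type `T`, with free variables declared in `Γ`.
In the rule for `Λ α. M` the new type variable `0` does not occur in the types of the variables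
that are free in `Λ α. M`: this is the eigenvariable condition. -/
inductive HasTy : List Ty → FTm → Ty → Prop
  | var {Γ : List Ty} {i : ℕ} {T : Ty} : Γ[i]? = some T → HasTy Γ (var i) T
  | lam {Γ : List Ty} {T U : Ty} {M : FTm} : HasTy (T :: Γ) M U → HasTy Γ (lam T M) (Ty.arr T U)
  | app {Γ : List Ty} {T U : Ty} {M N : FTm} :
      HasTy Γ M (Ty.arr T U) → HasTy Γ N T → HasTy Γ (app M N) U
  | tlam {Γ : List Ty} {U : Ty} {M : FTm} :
      HasTy (Γ.map Ty.up) M U → HasTy Γ (tlam M) (Ty.all U)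
  | tapp {Γ : List Ty} {U : Ty} {M : FTm} (T : Ty) :
      HasTy Γ M (Ty.all U) → HasTy Γ (tapp M T) (U.inst T)

/-- Number of symbols of a Church-style term in which every occurrence of a variable is written
`x^T`, together with its type. -/
def size : List Ty → FTm → ℕ
  | Γ, var i => 1 + (Γ[i]?.map Ty.size).getD 0
  | Γ, lam T M => size (T :: Γ) M + T.size + 1
  | Γ, app M N => size Γ M + size Γ N + 1
  | Γ, tlam M => size (Γ.map Ty.up) M + 1
  | Γ, tapp M T => size Γ M + T.size + 1

end FTm

/-! ### Types of `DLAL⋆` -/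

/-- Linear types `A ::= α | D ⊸ A | ∀ α. A | § A`, where `D ::= A | ! A`.
`lolli false A B` is `A ⊸ B` and `lolli true A B` is `! A ⊸ B`. -/
inductive LTy : Type
  | var (i : ℕ)
  | lolli (bang : Bool) (A B : LTy)
  | all (A : LTy)
  | sec (A : LTy)

/-- Arbitrary types `D`: `⟨false, A⟩` is the linear type `A` and `⟨true, A⟩` is `! A`. -/
structure DTy : Type where
  bang : Bool
  ty : LTy

namespace LTy

def rename (ρ : ℕ → ℕ) : LTy → LTy
  | var i => var (ρ i)
  | lolli b A B => lolli b (A.rename ρ) (B.rename ρ)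
  | all A => all (A.rename (upRen ρ))
  | sec A => sec (A.rename ρ)

def up (A : LTy) : LTy := A.rename Nat.succ

def upSub (σ : ℕ → LTy) : ℕ → LTy
  | 0 => var 0
  | n + 1 => (σ n).up

def subst : (ℕ → LTy) → LTy → LTy
  | σ, var i => σ i
  | σ, lolli b A B => lolli b (A.subst σ) (B.subst σ)
  | σ, all A => all (A.subst (upSub σ))
  | σ, sec A => sec (A.subst σ)

/-- `A.inst B` is `A[B/α]`, where `α` is the variable `0` of `A`. -/
def inst (A B : LTy) : LTy :=
  A.subst fun
    | 0 => B
    | n + 1 => var n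

/-- The type variable `i` occurs free. -/
def HasFV : ℕ → LTy → Prop
  | i, var j => i = j
  | i, lolli _ A B => A.HasFV i ∨ B.HasFV i
  | i, all A => A.HasFV (i + 1)
  | i, sec A => A.HasFV i

/-- `§ ⋯ § A`, with `n` modalities. -/
def secs : ℕ → LTy → LTy
  | 0, A => A
  | n + 1, A => sec (secs n A)

end LTy

namespace DTy

def up (D : DTy) : DTy := ⟨D.bang, D.ty.up⟩

/-- `D°` is `§ A` if `D = ! A`, and `D` otherwise. -/
def circ (D : DTy) : LTy := if D.bang then LTy.sec D.ty else D.ty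

end DTy

/-! ### Trees with binders, common to pseudo-terms and to parameterized terms -/

/-- Terms with variables, `λ`-abstractions annotated in `β`, applications, type abstractions,
type applications with arguments in `α`, and a unary node (a door) labelled in `δ`. -/
inductive Tm (β α δ : Type) : Type
  | var (i : ℕ)
  | lam (D : β) (t : Tm β α δ)
  | app (t u : Tm β α δ)
  | tlam (t : Tm β α δ)
  | tapp (t : Tm β α δ) (A : α)
  | door (d : δ) (t : Tm β α δ)

/-- `Occ up Γ t l k j Δ u`: there is an occurrence of the subterm `u` in `t` (taken in the context
`Γ`), `l` is the word of the doors on the path from the root of `t` to it, this path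
crosses `k` term abstractions and `j` type abstractions, and `Δ` is the context of `u`.
`up` is weakening by one type variable.  An occurrence `Tm.var i` is free in `t` iff `k ≤ i`. -/
inductive Occ {β α δ : Type} (up : β → β) :
    List β → Tm β α δ → List δ → ℕ → ℕ → List β → Tm β α δ → Prop
  | refl (Γ : List β) (t : Tm β α δ) : Occ up Γ t [] 0 0 Γ t
  | lam {Γ Δ : List β} {D : β} {t u : Tm β α δ} {l : List δ} {k j : ℕ} :
      Occ up (D :: Γ) t l k j Δ u → Occ up Γ (.lam D t) l (k + 1) j Δ u
  | app_left {Γ Δ : List β} {t t' u : Tm β α δ} {l : List δ} {k j : ℕ} :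
      Occ up Γ t l k j Δ u → Occ up Γ (.app t t') l k j Δ u
  | app_right {Γ Δ : List β} {t t' u : Tm β α δ} {l : List δ} {k j : ℕ} :
      Occ up Γ t' l k j Δ u → Occ up Γ (.app t t') l k j Δ u
  | tlam {Γ Δ : List β} {t u : Tm β α δ} {l : List δ} {k j : ℕ} :
      Occ up (Γ.map up) t l k j Δ u → Occ up Γ (.tlam t) l k (j + 1) Δ u
  | tapp {Γ Δ : List β} {A : α} {t u : Tm β α δ} {l : List δ} {k j : ℕ} :
      Occ up Γ t l k j Δ u → Occ up Γ (.tapp t A) l k j Δ u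
  | door {Γ Δ : List β} {d : δ} {t u : Tm β α δ} {l : List δ} {k j : ℕ} :
      Occ up Γ t l k j Δ u → Occ up Γ (.door d t) (d :: l) k j Δ u

namespace Tm

/-- Number of free occurrences of the variable `i`. -/
def count {β α δ : Type} : ℕ → Tm β α δ → ℕ
  | i, var j => if i = j then 1 else 0
  | i, lam _ t => count (i + 1) t
  | i, app t u => count i t + count i u
  | i, tlam t => count i t
  | i, tapp t _ => count i t
  | i, door _ t => count i t

/-- Number of occurrences of variables with index at least `k`; for `k = 0` this is the number of
all occurrences of free variables. -/
def freeOcc {β α δ : Type} : ℕ → Tm β α δ → ℕ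
  | k, var j => if k ≤ j then 1 else 0
  | k, lam _ t => freeOcc (k + 1) t
  | k, app t u => freeOcc k t + freeOcc k u
  | k, tlam t => freeOcc k t
  | k, tapp t _ => freeOcc k t
  | k, door _ t => freeOcc k t

end Tm

/-! ### Pseudo-terms -/

/-- The two doors: `opn` is `§`, `cls` is the auxiliary (barred) door. -/
inductive Door : Type
  | opn
  | cls

/-- Pseudo-terms. -/
abbrev PsTm : Type := Tm DTy LTy Door

namespace PsTm

/-- Output types. -/
inductive HasTy : List DTy → PsTm → LTy → Prop
  | var {Γ : List DTy} {i : ℕ} {D : DTy} : Γ[i]? = some D → HasTy Γ (.var i) D.circ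
  | lam {Γ : List DTy} {D : DTy} {t : PsTm} {B : LTy} :
      HasTy (D :: Γ) t B → HasTy Γ (.lam D t) (.lolli D.bang D.ty B)
  | app {Γ : List DTy} {D : DTy} {t u : PsTm} {A B : LTy} :
      HasTy Γ t (.lolli D.bang D.ty B) → HasTy Γ u A → D.circ = A → HasTy Γ (.app t u) B
  | opn {Γ : List DTy} {t : PsTm} {A : LTy} : HasTy Γ t A → HasTy Γ (.door .opn t) (.sec A)
  | cls {Γ : List DTy} {t : PsTm} {A : LTy} : HasTy Γ t (.sec A) → HasTy Γ (.door .cls t) A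
  | tlam {Γ : List DTy} {t : PsTm} {A : LTy} :
      HasTy (Γ.map DTy.up) t A → HasTy Γ (.tlam t) (.all A)
  | tapp {Γ : List DTy} {t : PsTm} {A : LTy} (B : LTy) :
      HasTy Γ t (.all A) → HasTy Γ (.tapp t B) (A.inst B)

/-- Local typing condition.  The second and the third clause say that a variable (free in `t`,
resp. bound in `t`) that occurs more than once has a bang type; the last one is
the eigenvariable condition. -/
structure LocalTyping (Γ : List DTy) (t : PsTm) : Prop where
  typed : ∃ A : LTy, HasTy Γ t A
  contr_free : ∀ i : ℕ, 1 < t.count i → ∃ D : DTy, Γ[i]? = some D ∧ D.bang = true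
  contr_bound : ∀ (l : List Door) (k j : ℕ) (Δ : List DTy) (D : DTy) (v : PsTm),
    Occ DTy.up Γ t l k j Δ (.lam D v) → 1 < v.count 0 → D.bang = true
  eigenvariable : ∀ (l : List Door) (k j : ℕ) (Δ : List DTy) (u : PsTm),
    Occ DTy.up Γ t l k j Δ (.tlam u) →
    ∀ (l' : List Door) (k' j' : ℕ) (Δ' : List DTy) (i : ℕ),
      Occ DTy.up (Δ.map DTy.up) u l' k' j' Δ' (.var i) → k' ≤ i →
      ∀ D : DTy, Δ'[i]? = some D → ¬ D.ty.HasFV j'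

/-- The map `s`: number of opening doors minus number of closing doors. -/
def s : List Door → ℤ
  | [] => 0
  | .opn :: l => 1 + s l
  | .cls :: l => -1 + s l

def WeaklyWellBracketed (l : List Door) : Prop := ∀ l' : List Door, l' <+: l → 0 ≤ s l'

def WellBracketed (l : List Door) : Prop := WeaklyWellBracketed l ∧ s l = 0

/-- Bracketing condition. -/
structure Bracketing (Γ : List DTy) (t : PsTm) : Prop where
  free : ∀ (l : List Door) (k j : ℕ) (Δ : List DTy) (i : ℕ),
    Occ DTy.up Γ t l k j Δ (.var i) → k ≤ i → WellBracketed l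
  abs : ∀ (l : List Door) (k j : ℕ) (Δ : List DTy) (D : DTy) (v : PsTm),
    Occ DTy.up Γ t l k j Δ (.lam D v) → WeaklyWellBracketed l
  bound : ∀ (l : List Door) (k j : ℕ) (Δ : List DTy) (D : DTy) (v : PsTm),
    Occ DTy.up Γ t l k j Δ (.lam D v) →
    ∀ (l' : List Door) (k' j' : ℕ) (Δ' : List DTy),
      Occ DTy.up (D :: Δ) v l' k' j' Δ' (.var k') → WellBracketed l'

/-- The Bang condition for one bang subterm `u`, in the context `Δ`. -/
structure BangCond (Δ : List DTy) (u : PsTm) : Prop where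
  /-- `u` has at most one occurrence of a free variable, -/
  one : u.freeOcc 0 ≤ 1
  /-- which has a bang type; -/
  bangVar : ∀ (l : List Door) (k j : ℕ) (Δ' : List DTy) (i : ℕ),
    Occ DTy.up Δ u l k j Δ' (.var i) → k ≤ i → ∃ D : DTy, Δ'[i]? = some D ∧ D.bang = true
  /-- `u` does not begin with a closing door; -/
  noClosing : ∀ w : PsTm, u ≠ .door .cls w
  /-- every subterm other than `u` and the free variable is at positive depth in `u`. -/
  inside : ∀ (l : List Door) (k j : ℕ) (Δ' : List DTy) (v : PsTm),
    Occ DTy.up Δ u l k j Δ' v → v ≠ u → (¬ ∃ i : ℕ, k ≤ i ∧ v = .var i) → 1 ≤ s l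

/-- Bang condition: all bang subterms, i.e. all `u` that occur in `t` as `(t') u` with
`t' : ! A ⊸ B`, satisfy `BangCond`. -/
def Bang (Γ : List DTy) (t : PsTm) : Prop :=
  ∀ (l : List Door) (k j : ℕ) (Δ : List DTy) (t' u : PsTm) (A B : LTy),
    Occ DTy.up Γ t l k j Δ (.app t' u) → HasTy Δ t' (.lolli true A B) → BangCond Δ u

/-- `Λ`-scope condition.  At the occurrence `v` in `u`, below `j'` type abstractions
of `u`, the variable `α` bound by `Λ α. u` has the index `j'`. -/
def Scope (Γ : List DTy) (t : PsTm) : Prop :=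
  ∀ (l : List Door) (k j : ℕ) (Δ : List DTy) (u : PsTm), Occ DTy.up Γ t l k j Δ (.tlam u) →
    ∀ (l' : List Door) (k' j' : ℕ) (Δ' : List DTy) (v : PsTm) (A : LTy),
      Occ DTy.up (Δ.map DTy.up) u l' k' j' Δ' v → HasTy Δ' v A → A.HasFV j' →
      WeaklyWellBracketed l'

/-- Regular pseudo-terms: no opening door directly above a closing one, nor conversely. -/
def Regular (Γ : List DTy) (t : PsTm) : Prop :=
  ∀ (l : List Door) (k j : ℕ) (Δ : List DTy) (v w : PsTm), Occ DTy.up Γ t l k j Δ v →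
    v ≠ .door .opn (.door .cls w) ∧ v ≠ .door .cls (.door .opn w)

/-- Well-structured pseudo-terms. -/
structure WellStructured (Γ : List DTy) (t : PsTm) : Prop where
  regular : Regular Γ t
  localTyping : LocalTyping Γ t
  bracketing : Bracketing Γ t
  bang : Bang Γ t
  scope : Scope Γ t

end PsTm

/-! ### Parameterized types and terms -/

/-- Linear combinations `n₁ + ⋯ + nₖ` of integer parameters, as formal sums.  Integer and boolean
parameters are two separate sorts, each named by natural numbers. -/
abbrev Lin : Type := Multiset ℕ

/-- The p-types without leading modality, `F ::= α | D ⊸ A | ∀ α. A`, with `A ::= §^c F` and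
`D ::= §^{b,c} F`: `arr b c F c' F'` is `(§^{b,c} F) ⊸ §^{c'} F'` and `all c F` is `∀ α. §^c F`. -/
inductive PF : Type
  | var (i : ℕ)
  | arr (b : ℕ) (c : Lin) (F : PF) (c' : Lin) (F' : PF)
  | all (c : Lin) (F : PF)

/-- Linear p-types `§^c F`. -/
structure PLin : Type where
  c : Lin
  F : PF

/-- Bang p-types `§^{b,c} F`. -/
structure PBang : Type where
  b : ℕ
  c : Lin
  F : PF

namespace PF

def rename (ρ : ℕ → ℕ) : PF → PF
  | var i => var (ρ i)
  | arr b c F c' F' => arr b c (F.rename ρ) c' (F'.rename ρ)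
  | all c F => all c (F.rename (upRen ρ))

def up (F : PF) : PF := F.rename Nat.succ

def upSub (σ : ℕ → PLin) : ℕ → PLin
  | 0 => ⟨0, var 0⟩
  | n + 1 => ⟨(σ n).c, (σ n).F.up⟩

/-- Substitution of linear p-types for type variables.  A variable `α` below `§^{c'}` or
`§^{b,c'}` for which `§^c F` is substituted becomes `F`, and the modality above it becomes
`§^{c'+c}`, resp. `§^{b,c'+c}`. -/
def subst : (ℕ → PLin) → PF → PLin
  | σ, var i => σ i
  | σ, arr b c F c' F' =>
      ⟨0, arr b (c + (F.subst σ).c) (F.subst σ).F (c' + (F'.subst σ).c) (F'.subst σ).F⟩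
  | σ, all c F => ⟨0, all (c + (F.subst (upSub σ)).c) (F.subst (upSub σ)).F⟩

/-- The type variable `i` occurs free. -/
def HasFV : ℕ → PF → Prop
  | i, var j => i = j
  | i, arr _ _ F _ F' => F.HasFV i ∨ F'.HasFV i
  | i, all _ F => F.HasFV (i + 1)

/-- Underlying system F type. -/
def erase : PF → Ty
  | var i => .var i
  | arr _ _ F _ F' => .arr F.erase F'.erase
  | all _ F => .all F.erase

/-- All linear combinations are single parameters. -/
def Simple : PF → Prop
  | var _ => True
  | arr _ c F c' F' => c.card = 1 ∧ F.Simple ∧ c'.card = 1 ∧ F'.Simple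
  | all c F => c.card = 1 ∧ F.Simple

/-- Integer parameters, with multiplicity. -/
def iparams : PF → Multiset ℕ
  | var _ => 0
  | arr _ c F c' F' => c + F.iparams + (c' + F'.iparams)
  | all c F => c + F.iparams

/-- Boolean parameters, with multiplicity. -/
def bparams : PF → Multiset ℕ
  | var _ => 0
  | arr b _ F _ F' => {b} + F.bparams + F'.bparams
  | all _ F => F.bparams

end PF

namespace PLin

/-- `B.inst A` is `B[A/α]`, where `α` is the variable `0` of `B`. -/
def inst (B A : PLin) : PLin :=
  let E := B.F.subst fun
    | 0 => A
    | n + 1 => ⟨0, .var n⟩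
  ⟨B.c + E.c, E.F⟩

/-- `A` is a linear p-type over `T` whose linear combinations are single parameters. -/
def Decorates (A : PLin) (T : Ty) : Prop := A.F.erase = T ∧ A.c.card = 1 ∧ A.F.Simple

end PLin

namespace PBang

def up (D : PBang) : PBang := ⟨D.b, D.c, D.F.up⟩

/-- `D°`. -/
def circ (D : PBang) : PLin := ⟨D.c, D.F⟩

/-- `D` is a bang p-type over `T` whose linear combinations are single parameters. -/
def Decorates (D : PBang) (T : Ty) : Prop := D.F.erase = T ∧ D.c.card = 1 ∧ D.F.Simple

end PBang

/-- Parameterized terms; the door `Tm.door m t` is `§^m t`. -/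
abbrev PTm : Type := Tm PBang PLin ℕ

namespace PTm

/-- Integer parameters, with multiplicity (a parameter in the type of a bound variable
is counted at the binder only). -/
def iparams : PTm → Multiset ℕ
  | .var _ => 0
  | .lam D t => D.c + D.F.iparams + iparams t
  | .app t u => iparams t + iparams u
  | .tlam t => iparams t
  | .tapp t A => iparams t + (A.c + A.F.iparams)
  | .door m t => {m} + iparams t

/-- Boolean parameters, with multiplicity. -/
def bparams : PTm → Multiset ℕ
  | .var _ => 0
  | .lam D t => {D.b} + D.F.bparams + bparams t
  | .app t u => bparams t + bparams u
  | .tlam t => bparams t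
  | .tapp t A => bparams t + A.F.bparams
  | .door _ t => bparams t

end PTm

/-- `Lifts M t`: `t` is obtained from `M` by putting a door `§^m` above every
node and decorating all types, with arbitrary parameters. -/
inductive Lifts : FTm → PTm → Prop
  | var (m i : ℕ) : Lifts (.var i) (.door m (.var i))
  | lam (m : ℕ) {T : Ty} {D : PBang} {M : FTm} {t : PTm} :
      D.Decorates T → Lifts M t → Lifts (.lam T M) (.door m (.lam D t))
  | app (m : ℕ) {M N : FTm} {t u : PTm} :
      Lifts M t → Lifts N u → Lifts (.app M N) (.door m (.app t u))
  | tlam (m : ℕ) {M : FTm} {t : PTm} : Lifts M t → Lifts (.tlam M) (.door m (.tlam t))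
  | tapp (m : ℕ) {T : Ty} {A : PLin} {M : FTm} {t : PTm} :
      A.Decorates T → Lifts M t → Lifts (.tapp M T) (.door m (.tapp t A))

/-- The p-term `t`, in the p-context `P` that gives the p-types of its free variables, is a free
decoration of `M`: it is a lifting of `M` and all its parameters are mutually distinct. -/
structure IsFreeDecoration (Γ : List Ty) (M : FTm) (P : List PBang) (t : PTm) : Prop where
  ctx : List.Forall₂ PBang.Decorates P Γ
  lifts : Lifts M t
  int_distinct : ((P.map fun D => D.c + D.F.iparams).sum + PTm.iparams t).Nodup
  bool_distinct : ((P.map fun D => {D.b} + D.F.bparams).sum + PTm.bparams t).Nodup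

/-! ### Instantiations -/

/-- Instantiations of the boolean and of the integer parameters (the values at parameters that do
not occur are irrelevant). -/
structure Inst : Type where
  bool : ℕ → Bool
  int : ℕ → ℤ

namespace Inst

/-- Value of a linear combination. -/
def eval (φ : Inst) (c : Lin) : ℤ := (c.map φ.int).sum

/-- Admissibility for a p-type. -/
def AdmF (φ : Inst) : PF → Prop
  | .var _ => True
  | .arr b c F c' F' =>
      0 ≤ φ.eval c ∧ (φ.bool b = true → 1 ≤ φ.eval c) ∧ φ.AdmF F ∧ 0 ≤ φ.eval c' ∧ φ.AdmF F'
  | .all c F => 0 ≤ φ.eval c ∧ φ.AdmF F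

def AdmLin (φ : Inst) (A : PLin) : Prop := 0 ≤ φ.eval A.c ∧ φ.AdmF A.F

def AdmBang (φ : Inst) (D : PBang) : Prop :=
  0 ≤ φ.eval D.c ∧ (φ.bool D.b = true → 1 ≤ φ.eval D.c) ∧ φ.AdmF D.F

/-- Admissibility for a p-term: for all p-types occurring in it, including
those of its free variables. -/
structure Admissible (φ : Inst) (P : List PBang) (t : PTm) : Prop where
  free : ∀ (i : ℕ) (D : PBang), 0 < t.count i → P[i]? = some D → φ.AdmBang D
  lam : ∀ (l : List ℕ) (k j : ℕ) (Δ : List PBang) (D : PBang) (v : PTm),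
    Occ PBang.up P t l k j Δ (.lam D v) → φ.AdmBang D
  tapp : ∀ (l : List ℕ) (k j : ℕ) (Δ : List PBang) (v : PTm) (A : PLin),
    Occ PBang.up P t l k j Δ (.tapp v A) → φ.AdmLin A

/-- The linear type `§^(φ c) A` or the type `§^(φ c) A`, resp. `! §^(φ c - 1) A`, according to
the value of `b`; meaningful for admissible `φ` only. -/
def bangTy (φ : Inst) (b : ℕ) (c : Lin) (A : LTy) : DTy :=
  if φ.bool b then ⟨true, LTy.secs (φ.eval c - 1).toNat A⟩
  else ⟨false, LTy.secs (φ.eval c).toNat A⟩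

def onF (φ : Inst) : PF → LTy
  | .var i => .var i
  | .arr b c F c' F' =>
      .lolli (φ.bangTy b c (φ.onF F)).bang (φ.bangTy b c (φ.onF F)).ty
        (LTy.secs (φ.eval c').toNat (φ.onF F'))
  | .all c F => .all (LTy.secs (φ.eval c).toNat (φ.onF F))

/-- `φ(A)` for a linear p-type `A`. -/
def onLin (φ : Inst) (A : PLin) : LTy := LTy.secs (φ.eval A.c).toNat (φ.onF A.F)

/-- `φ(D)` for a bang p-type `D`. -/
def onBang (φ : Inst) (D : PBang) : DTy := φ.bangTy D.b D.c (φ.onF D.F)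

/-- `n` doors of the kind `d`. -/
def doors (d : Door) : ℕ → PsTm → PsTm
  | 0, t => t
  | n + 1, t => .door d (doors d n t)

/-- `§^n t` for an integer `n`: `n` opening doors if `0 ≤ n`, and `-n` closing doors otherwise. -/
def secPow (n : ℤ) (t : PsTm) : PsTm :=
  if 0 ≤ n then doors .opn n.toNat t else doors .cls (-n).toNat t

/-- `φ(t)`. -/
def onTm (φ : Inst) : PTm → PsTm
  | .var i => .var i
  | .lam D t => .lam (φ.onBang D) (φ.onTm t)
  | .app t u => .app (φ.onTm t) (φ.onTm u)
  | .tlam t => .tlam (φ.onTm t)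
  | .tapp t A => .tapp (φ.onTm t) (φ.onLin A)
  | .door m t => secPow (φ.int m) (φ.onTm t)

end Inst

/-! ### Constraints -/

/-- Constraints on parameters. -/
inductive Constr : Type
  /-- `b = b'` -/
  | boolEq (b b' : ℕ)
  /-- `b = 1` -/
  | boolOne (b : ℕ)
  /-- `b = 0` -/
  | boolZero (b : ℕ)
  /-- `b = 1 ⇒ b' = 1` -/
  | boolImp (b b' : ℕ)
  /-- `c = c'` -/
  | linEq (c c' : Lin)
  /-- `c ≥ 0` -/
  | linNonneg (c : Lin)
  /-- `b = 1 ⇒ c ≥ 1` -/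
  | impPos (b : ℕ) (c : Lin)
  /-- `b = 1 ⇒ c = 0` -/
  | impZero (b : ℕ) (c : Lin)

/-- `φ` satisfies a constraint. -/
def Constr.Sat (φ : Inst) : Constr → Prop
  | boolEq b b' => φ.bool b = φ.bool b'
  | boolOne b => φ.bool b = true
  | boolZero b => φ.bool b = false
  | boolImp b b' => φ.bool b = true → φ.bool b' = true
  | linEq c c' => φ.eval c = φ.eval c'
  | linNonneg c => 0 ≤ φ.eval c
  | impPos b c => φ.bool b = true → 1 ≤ φ.eval c
  | impZero b c => φ.bool b = true → φ.eval c = 0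

/-- `φ` is a solution of a set of constraints. -/
def Inst.Solves (φ : Inst) (C : Set Constr) : Prop := ∀ κ ∈ C, κ.Sat φ

/-- `U(F₁, F₂)`; it is used only for p-types with the same erasure, for which
the last case does not occur. -/
def unifF : PF → PF → Set Constr
  | .var _, .var _ => ∅
  | .arr b₁ c₁ F₁ c₁' F₁', .arr b₂ c₂ F₂ c₂' F₂' =>
      {.boolEq b₁ b₂, .linEq c₁ c₂} ∪ unifF F₁ F₂ ∪ ({.linEq c₁' c₂'} ∪ unifF F₁' F₂')
  | .all c₁ F₁, .all c₂ F₂ => {.linEq c₁ c₂} ∪ unifF F₁ F₂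
  | _, _ => ∅

/-- `U(A₁, A₂)` for linear p-types. -/
def unifLin (A₁ A₂ : PLin) : Set Constr := {.linEq A₁.c A₂.c} ∪ unifF A₁.F A₂.F

/-- `Adm` of the p-types inside `F`. -/
def admF : PF → Set Constr
  | .var _ => ∅
  | .arr b c F c' F' =>
      {.linNonneg c, .impPos b c} ∪ admF F ∪ ({.linNonneg c'} ∪ admF F')
  | .all c F => {.linNonneg c} ∪ admF F

def admLin (A : PLin) : Set Constr := {.linNonneg A.c} ∪ admF A.F

def admBang (D : PBang) : Set Constr := {.linNonneg D.c, .impPos D.b D.c} ∪ admF D.F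

namespace PTm

/-- `Typing P t A C`: the p-term `t` receives the linear p-type `A` and the set of constraints `C`,
the types of the free variables being given by `P`. -/
inductive Typing : List PBang → PTm → PLin → Set Constr → Prop
  | var {P : List PBang} {i : ℕ} {D : PBang} :
      P[i]? = some D → Typing P (.var i) D.circ (admBang D)
  | door {P : List PBang} {m : ℕ} {t : PTm} {A : PLin} {C : Set Constr} :
      Typing P t A C → Typing P (.door m t) ⟨{m} + A.c, A.F⟩ (C ∪ {.linNonneg ({m} + A.c)})
  | lam {P : List PBang} {D : PBang} {t : PTm} {A : PLin} {C : Set Constr} :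
      Typing (D :: P) t A C → Typing P (.lam D t) ⟨0, .arr D.b D.c D.F A.c A.F⟩ (C ∪ admBang D)
  | app {P : List PBang} {D : PBang} {t u : PTm} {c : Lin} {A B : PLin} {C₁ C₂ : Set Constr} :
      Typing P t ⟨c, .arr D.b D.c D.F B.c B.F⟩ C₁ → Typing P u A C₂ → D.F.erase = A.F.erase →
      Typing P (.app t u) B (C₁ ∪ C₂ ∪ {.linEq c 0} ∪ unifLin D.circ A)
  | tlam {P : List PBang} {t : PTm} {A : PLin} {C : Set Constr} :
      Typing (P.map PBang.up) t A C → Typing P (.tlam t) ⟨0, .all A.c A.F⟩ C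
  | tapp {P : List PBang} {t : PTm} {c : Lin} {A B : PLin} {C : Set Constr} :
      Typing P t ⟨c, .all B.c B.F⟩ C →
      Typing P (.tapp t A) (B.inst A) (C ∪ {.linEq c 0} ∪ admLin A)

/-- `Ltype(t)`. -/
def ltype (P : List PBang) (t : PTm) : Set Constr :=
  {κ | ∃ (A : PLin) (C : Set Constr), Typing P t A C ∧ κ ∈ C} ∪
  {κ | ∃ (i : ℕ) (D : PBang), P[i]? = some D ∧ 1 < t.count i ∧ κ = .boolOne D.b} ∪
  {κ | ∃ (l : List ℕ) (k j : ℕ) (Δ : List PBang) (D : PBang) (v : PTm),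
    Occ PBang.up P t l k j Δ (.lam D v) ∧ 1 < v.count 0 ∧ κ = .boolOne D.b}

/-- `wbracket(l)`; the sum `s(l)` of a word of parameters is the word as a multiset. -/
def wbracket (l : List ℕ) : Set Constr :=
  {κ | ∃ l' : List ℕ, l' <+: l ∧ κ = .linNonneg (l' : Multiset ℕ)}

/-- `bracket(l)`. -/
def bracket (l : List ℕ) : Set Constr := wbracket l ∪ {.linEq (l : Multiset ℕ) 0}

/-- `Bracket(t)`. -/
def bracketing (P : List PBang) (t : PTm) : Set Constr :=
  {κ | ∃ (l : List ℕ) (k j : ℕ) (Δ : List PBang) (i : ℕ),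
    Occ PBang.up P t l k j Δ (.var i) ∧ k ≤ i ∧ κ ∈ bracket l} ∪
  {κ | ∃ (l : List ℕ) (k j : ℕ) (Δ : List PBang) (D : PBang) (v : PTm),
    Occ PBang.up P t l k j Δ (.lam D v) ∧ κ ∈ wbracket l} ∪
  {κ | ∃ (l : List ℕ) (k j : ℕ) (Δ : List PBang) (D : PBang) (v : PTm),
    Occ PBang.up P t l k j Δ (.lam D v) ∧
    ∃ (l' : List ℕ) (k' j' : ℕ) (Δ' : List PBang),
      Occ PBang.up (D :: Δ) v l' k' j' Δ' (.var k') ∧ κ ∈ bracket l'}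

/-- The constraints for one bang subterm `u`, in the p-context `Δ`, with critical
parameter `b`. -/
def bangCond (Δ : List PBang) (u : PTm) (b : ℕ) : Set Constr :=
  {κ | 1 < u.freeOcc 0 ∧ κ = .boolZero b} ∪
  {κ | u.freeOcc 0 = 1 ∧
    ∃ (l : List ℕ) (k j : ℕ) (Δ' : List PBang) (i : ℕ) (D : PBang),
      Occ PBang.up Δ u l k j Δ' (.var i) ∧ k ≤ i ∧ Δ'[i]? = some D ∧ κ = .boolImp b D.b} ∪
  {κ | ∃ (l : List ℕ) (k j : ℕ) (Δ' : List PBang) (v : PTm),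
    Occ PBang.up Δ u l k j Δ' v ∧ v ≠ u ∧ (¬ ∃ i : ℕ, k ≤ i ∧ v = .var i) ∧
    κ = .impPos b (l : Multiset ℕ)} ∪
  {κ | ∃ (l : List ℕ) (k j : ℕ) (Δ' : List PBang) (i : ℕ),
    Occ PBang.up Δ u l k j Δ' (.var i) ∧ k ≤ i ∧ κ = .impZero b (l : Multiset ℕ)}

/-- `Bang(t)`. -/
def bang (P : List PBang) (t : PTm) : Set Constr :=
  {κ | ∃ (l : List ℕ) (k j : ℕ) (Δ : List PBang) (t' u : PTm)
      (c' : Lin) (D : PBang) (B : PLin) (C : Set Constr),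
    Occ PBang.up P t l k j Δ (.app t' u) ∧
    Typing Δ t' ⟨c', .arr D.b D.c D.F B.c B.F⟩ C ∧ κ ∈ bangCond Δ u D.b}

/-- `Scope(t)`. -/
def scope (P : List PBang) (t : PTm) : Set Constr :=
  {κ | ∃ (l : List ℕ) (k j : ℕ) (Δ : List PBang) (u : PTm),
    Occ PBang.up P t l k j Δ (.tlam u) ∧
    ∃ (l' : List ℕ) (k' j' : ℕ) (Δ' : List PBang) (v : PTm) (A : PLin) (C : Set Constr),
      Occ PBang.up (Δ.map PBang.up) u l' k' j' Δ' v ∧ Typing Δ' v A C ∧ A.F.HasFV j' ∧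
      κ ∈ wbracket l'}

/-- `Const(t)`. -/
def const (P : List PBang) (t : PTm) : Set Constr :=
  ltype P t ∪ bracketing P t ∪ bang P t ∪ scope P t

end PTm

end DLAL

/-!
The equivalence is a comparison of the p-term `t` with its instance `φ(t)`, condition by condition.

*Typing.* The rules for p-terms and for pseudo-terms are both syntax directed. If `φ` solves the
typing constraints of `t : A`, then `A` is admissible, instantiation commutes with substitution,
and `φ(t) : φ(A)` (`Inst.hasTy_onTm`). Conversely, a type of `φ(t)` has to be `φ(A)`. An
instantiated p-type determines the values of the parameters in it, because the number of
modalities above a type that does not begin with `§` can be read off; so every equation between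
types that the rules for pseudo-terms demand is the corresponding set of equations between
parameters (`PTm.Typing.solves`).

*Words.* Occurrences in `φ(t)` are instances of occurrences in `t`, or lie inside the block of
`|φ(m)|` equal doors into which some `§^m` is instantiated (`Inst.exists_origin`). Along such a
block the height is monotone, so weak bracketing may be tested at the ends of the blocks
(`Inst.weaklyWellBracketed_expand`).

*Bang.* The constraints on a bang subterm `u = §^m w` look stricter than the condition on
`φ(u)`: they also demand `s(u‖x) = 0` for the free variable `x`, and if `φ(m) = 0` they do not
exempt `w` although then `φ(u) = φ(w)`. The first follows from the bracketing
condition, which gives `s(u‖x) ≤ 0` (`Inst.s_nonpos_of_bracketing`), together with the fact that no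
word in `u` has negative height (`PsTm.BangCond.s_nonneg`). For the second, `φ(u)` has a type
`§ B`, and a bang subterm of such a type without a door at its root is a variable
(`Inst.exists_eq_var_of_bangCond`).

*Counting.* The words in bracketing constraints are all words of occurrences, so every binder or
application contributes linearly many of them. The typing constraints need more care, because
the output p-type of a subterm can be exponentially larger than the subterm: substitution
duplicates p-types. But it duplicates their parameters as well, and the number of distinct linear
combinations in the output type stays linear (`PTm.Typing.cardLE_places`). Hence an application
`(t) u` contributes at most a constant times `|t| |u|` unification constraints, and these
products sum up to a quadratic bound (`PTm.Typing.cardLE_constr`).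
-/

namespace DLAL

/-! ### Modalities, renaming and substitution on linear types -/

namespace LTy

theorem secs_add (m n : ℕ) (A : LTy) : secs (m + n) A = secs m (secs n A) := by
  induction m with
  | zero => simp [secs]
  | succ m ih => rw [Nat.succ_add, secs, secs, ih]

theorem secs_sec (n : ℕ) (A : LTy) : secs n (sec A) = sec (secs n A) := by
  induction n with
  | zero => rfl
  | succ n ih => rw [secs, ih, secs]

theorem rename_secs (ρ : ℕ → ℕ) (n : ℕ) (A : LTy) :
    (secs n A).rename ρ = secs n (A.rename ρ) := by
  induction n with
  | zero => rfl
  | succ n ih => simp [secs, rename, ih]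

theorem subst_secs (σ : ℕ → LTy) (n : ℕ) (A : LTy) :
    (secs n A).subst σ = secs n (A.subst σ) := by
  induction n with
  | zero => rfl
  | succ n ih => simp [secs, subst, ih]

theorem hasFV_secs {n : ℕ} {A : LTy} {i : ℕ} : (secs n A).HasFV i ↔ A.HasFV i := by
  induction n with
  | zero => rfl
  | succ n ih => simpa [secs, HasFV] using ih

theorem hasFV_rename {ρ : ℕ → ℕ} {A : LTy} {i : ℕ} :
    (A.rename ρ).HasFV i ↔ ∃ k, ρ k = i ∧ A.HasFV k := by
  induction A generalizing ρ i with
  | var j => simp [rename, HasFV, eq_comm]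
  | lolli b A B ihA ihB =>
    simp only [rename, HasFV, ihA, ihB, ← exists_or, and_or_left]
  | all A ih =>
    simp only [rename, HasFV, ih]
    constructor
    · rintro ⟨_ | k, hk, h⟩
      · simp [upRen] at hk
      · exact ⟨k, by simpa [upRen] using hk, h⟩
    · rintro ⟨k, hk, h⟩
      exact ⟨k + 1, by simpa [upRen] using hk, h⟩
  | sec A ih => simpa only [rename, HasFV] using ih

theorem hasFV_up_succ {A : LTy} {i : ℕ} : A.up.HasFV (i + 1) ↔ A.HasFV i := by
  simp [up, hasFV_rename]

theorem not_hasFV_up_zero (A : LTy) : ¬ A.up.HasFV 0 := by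
  simp [up, hasFV_rename]

/-- The number of leading modalities and the type below them are determined by the type. -/
theorem secs_injective {m n : ℕ} {A B : LTy} (hA : ∀ X, A ≠ sec X) (hB : ∀ X, B ≠ sec X)
    (h : secs m A = secs n B) : m = n ∧ A = B := by
  induction m generalizing n with
  | zero =>
    cases n with
    | zero => exact ⟨rfl, h⟩
    | succ n => exact absurd h (hA _)
  | succ m ih =>
    cases n with
    | zero => exact absurd h.symm (hB _)
    | succ n =>
      obtain ⟨h₁, h₂⟩ := ih (sec.inj h)
      exact ⟨by rw [h₁], h₂⟩

theorem le_of_secs_eq {m n : ℕ} {A B : LTy} (hA : ∀ X, A ≠ sec X)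
    (h : secs m A = secs n B) : n ≤ m := by
  induction m generalizing n with
  | zero =>
    cases n with
    | zero => exact le_rfl
    | succ n => exact absurd h (hA _)
  | succ m ih =>
    cases n with
    | zero => exact Nat.zero_le _
    | succ n => exact Nat.succ_le_succ (ih (sec.inj h))

end LTy

/-! ### Instantiated types -/

/-- The substitution of a linear p-type for the type variable `0`. -/
def PLin.single (A : PLin) : ℕ → PLin
  | 0 => A
  | n + 1 => ⟨0, .var n⟩

theorem PLin.inst_eq (B A : PLin) :
    B.inst A = ⟨B.c + (B.F.subst A.single).c, (B.F.subst A.single).F⟩ := by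
  have : (fun | 0 => A | n + 1 => ⟨0, .var n⟩ : ℕ → PLin) = A.single := by
    funext i
    cases i <;> rfl
  rw [← this]
  rfl

namespace Inst

variable (φ : Inst)

theorem eval_add (c c' : Lin) : φ.eval (c + c') = φ.eval c + φ.eval c' := by
  simp [eval]

@[simp] theorem eval_zero : φ.eval 0 = 0 := by simp [eval]

@[simp] theorem eval_singleton (m : ℕ) : φ.eval {m} = φ.int m := by simp [eval]

theorem bangTy_rename (ρ : ℕ → ℕ) (b : ℕ) (c : Lin) (A : LTy) :
    φ.bangTy b c (A.rename ρ) = ⟨(φ.bangTy b c A).bang, (φ.bangTy b c A).ty.rename ρ⟩ := by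
  unfold bangTy
  split <;> simp [LTy.rename_secs]

theorem onF_rename (ρ : ℕ → ℕ) (F : PF) : φ.onF (F.rename ρ) = (φ.onF F).rename ρ := by
  induction F generalizing ρ with
  | var i => rfl
  | arr b c F c' F' ih ih' =>
    simp [PF.rename, onF, LTy.rename, ih, ih', bangTy_rename, LTy.rename_secs]
  | all c F ih => simp [PF.rename, onF, LTy.rename, ih, LTy.rename_secs]

theorem onBang_up (D : PBang) : φ.onBang D.up = (φ.onBang D).up := by
  simp [onBang, PBang.up, DTy.up, PF.up, LTy.up, onF_rename, bangTy_rename]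

theorem map_onBang_up (P : List PBang) :
    (P.map PBang.up).map φ.onBang = (P.map φ.onBang).map DTy.up := by
  simp [Function.comp_def, onBang_up]

theorem onF_ne_sec (F : PF) (X : LTy) : φ.onF F ≠ .sec X := by
  cases F <;> simp [onF]

theorem onBang_bang (D : PBang) : (φ.onBang D).bang = φ.bool D.b := by
  unfold onBang bangTy
  split <;> simp_all

theorem hasFV_bangTy (b : ℕ) (c : Lin) (A : LTy) (i : ℕ) :
    (φ.bangTy b c A).ty.HasFV i ↔ A.HasFV i := by
  unfold bangTy
  split <;> exact LTy.hasFV_secs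

theorem hasFV_onF (F : PF) (i : ℕ) : (φ.onF F).HasFV i ↔ F.HasFV i := by
  induction F generalizing i with
  | var j => rfl
  | arr b c F c' F' ih ih' =>
    simp only [onF, LTy.HasFV, PF.HasFV, hasFV_bangTy, LTy.hasFV_secs, ih, ih']
  | all c F ih => simp only [onF, LTy.HasFV, PF.HasFV, LTy.hasFV_secs, ih]

theorem hasFV_onLin (A : PLin) (i : ℕ) : (φ.onLin A).HasFV i ↔ A.F.HasFV i := by
  rw [onLin, LTy.hasFV_secs, hasFV_onF]

variable {φ}

theorem secs_eval_add {c c' : Lin} (h : 0 ≤ φ.eval c) (h' : 0 ≤ φ.eval c') (A : LTy) :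
    LTy.secs (φ.eval (c + c')).toNat A
      = LTy.secs (φ.eval c).toNat (LTy.secs (φ.eval c').toNat A) := by
  rw [← LTy.secs_add, eval_add, Int.toNat_add h h']

theorem bangTy_add {b : ℕ} {c c' : Lin} (h : 0 ≤ φ.eval c)
    (hb : φ.bool b = true → 1 ≤ φ.eval c) (h' : 0 ≤ φ.eval c') (A : LTy) :
    φ.bangTy b (c + c') A = φ.bangTy b c (LTy.secs (φ.eval c').toNat A) := by
  unfold bangTy
  split
  next hbt =>
    have := hb hbt
    rw [← LTy.secs_add, eval_add, ← Int.toNat_add (by omega) h']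
    congr 3
    omega
  next => rw [secs_eval_add h h']

/-- For admissible values the two readings of a bang p-type agree: `φ(D)° = φ(D°)`. -/
theorem circ_bangTy {b : ℕ} {c : Lin} (hb : φ.bool b = true → 1 ≤ φ.eval c) (A : LTy) :
    (φ.bangTy b c A).circ = LTy.secs (φ.eval c).toNat A := by
  unfold bangTy DTy.circ
  split
  next hbt =>
    have := hb hbt
    obtain ⟨n, hn⟩ : ∃ n : ℕ, φ.eval c = n + 1 := ⟨(φ.eval c - 1).toNat, by omega⟩
    rw [hn]
    have h₁ : ((n : ℤ) + 1 - 1).toNat = n := by omega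
    have h₂ : ((n : ℤ) + 1).toNat = n + 1 := by omega
    simp [h₂, LTy.secs]
  next => simp

theorem circ_onBang {D : PBang} (h : φ.AdmBang D) : (φ.onBang D).circ = φ.onLin D.circ :=
  circ_bangTy h.2.1 _

theorem subst_bangTy (σ : ℕ → LTy) (b : ℕ) (c : Lin) (A : LTy) :
    (φ.bangTy b c A).ty.subst σ = (φ.bangTy b c (A.subst σ)).ty := by
  unfold bangTy
  split <;> simp [LTy.subst_secs]

theorem bang_bangTy (b : ℕ) (c : Lin) (A : LTy) : (φ.bangTy b c A).bang = φ.bool b := by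
  unfold bangTy
  split <;> simp_all

theorem admF_rename {ρ : ℕ → ℕ} {F : PF} : φ.AdmF (F.rename ρ) ↔ φ.AdmF F := by
  induction F generalizing ρ with
  | var i => rfl
  | arr b c F c' F' ih ih' => simp only [PF.rename, AdmF, ih, ih']
  | all c F ih => simp only [PF.rename, AdmF, ih]

theorem admBang_up {D : PBang} : φ.AdmBang D.up ↔ φ.AdmBang D := by
  simp only [AdmBang, PBang.up, PF.up, admF_rename]

theorem admLin_upSub {σ : ℕ → PLin} (hσ : ∀ i, φ.AdmLin (σ i)) (i : ℕ) :
    φ.AdmLin (PF.upSub σ i) := by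
  cases i with
  | zero => simp [PF.upSub, AdmLin, AdmF]
  | succ i => exact ⟨(hσ i).1, admF_rename.2 (hσ i).2⟩

theorem admLin_subst {σ : ℕ → PLin} (hσ : ∀ i, φ.AdmLin (σ i)) {F : PF} (hF : φ.AdmF F) :
    φ.AdmLin (F.subst σ) := by
  induction F generalizing σ with
  | var i => exact hσ i
  | arr b c F c' F' ih ih' =>
    obtain ⟨h₁, h₂, h₃, h₄, h₅⟩ := hF
    obtain ⟨i₁, i₂⟩ := ih hσ h₃
    obtain ⟨j₁, j₂⟩ := ih' hσ h₅
    refine ⟨by simp [PF.subst], ?_⟩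
    simp only [PF.subst, AdmF, eval_add]
    exact ⟨by omega, fun hb => by have := h₂ hb; omega, i₂, by omega, j₂⟩
  | all c F ih =>
    obtain ⟨i₁, i₂⟩ := ih (admLin_upSub hσ) hF.2
    have := hF.1
    refine ⟨by simp [PF.subst], ?_⟩
    simp only [PF.subst, AdmF, eval_add]
    exact ⟨by omega, i₂⟩

theorem onLin_upSub (σ : ℕ → PLin) :
    (fun i => φ.onLin (PF.upSub σ i)) = LTy.upSub fun i => φ.onLin (σ i) := by
  funext i
  cases i with
  | zero => simp [PF.upSub, LTy.upSub, onLin, onF, LTy.secs]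
  | succ i => simp [PF.upSub, LTy.upSub, onLin, LTy.up, PF.up, LTy.rename_secs, onF_rename]

/-- Instantiation commutes with substitution. Admissibility is what makes the truncations in
the exponents harmless. -/
theorem onLin_subst {σ : ℕ → PLin} (hσ : ∀ i, φ.AdmLin (σ i)) {F : PF} (hF : φ.AdmF F) :
    φ.onLin (F.subst σ) = (φ.onF F).subst fun i => φ.onLin (σ i) := by
  induction F generalizing σ with
  | var i => rfl
  | arr b c F c' F' ih ih' =>
    obtain ⟨h₁, h₂, h₃, h₄, h₅⟩ := hF
    have e := ih hσ h₃
    have e' := ih' hσ h₅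
    simp only [onF, LTy.subst, subst_bangTy, LTy.subst_secs, ← e, ← e', bang_bangTy]
    simp only [PF.subst, onLin, eval_zero, Int.toNat_zero, LTy.secs, onF, bang_bangTy]
    rw [bangTy_add h₁ h₂ (admLin_subst hσ h₃).1, secs_eval_add h₄ (admLin_subst hσ h₅).1]
  | all c F ih =>
    have e := ih (admLin_upSub hσ) hF.2
    rw [onLin_upSub] at e
    simp only [onF, LTy.subst, LTy.subst_secs, ← e]
    simp only [PF.subst, onLin, eval_zero, Int.toNat_zero, LTy.secs, onF]
    rw [secs_eval_add hF.1 (admLin_subst (admLin_upSub hσ) hF.2).1]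

theorem admLin_single {A : PLin} (hA : φ.AdmLin A) (i : ℕ) : φ.AdmLin (A.single i) := by
  cases i with
  | zero => exact hA
  | succ i => simp [PLin.single, AdmLin, AdmF]

theorem onLin_single (A : PLin) :
    (fun i => φ.onLin (A.single i)) = fun
      | 0 => φ.onLin A
      | n + 1 => LTy.var n := by
  funext i
  cases i with
  | zero => rfl
  | succ i => simp [PLin.single, onLin, onF, LTy.secs]

theorem admLin_inst {A B : PLin} (hA : φ.AdmLin A) (hB : φ.AdmLin B) :
    φ.AdmLin (B.inst A) := by
  have h := admLin_subst (admLin_single hA) hB.2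
  have h₁ := h.1
  have h₂ := hB.1
  rw [PLin.inst_eq]
  refine ⟨?_, h.2⟩
  rw [eval_add]
  omega

theorem onLin_inst {A B : PLin} (hA : φ.AdmLin A) (hB : φ.AdmLin B) :
    φ.onLin (B.inst A) = (φ.onLin B).inst (φ.onLin A) := by
  have h := admLin_subst (admLin_single hA) hB.2
  have e := onLin_subst (admLin_single hA) hB.2
  rw [onLin_single] at e
  rw [PLin.inst_eq]
  conv_lhs => rw [onLin]
  rw [secs_eval_add hB.1 h.1]
  change _ = (LTy.secs (φ.eval B.c).toNat (φ.onF B.F)).subst _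
  rw [LTy.subst_secs]
  exact congrArg (LTy.secs _) e

/-! ### Unification and admissibility constraints -/

theorem solves_union {C C' : Set Constr} : φ.Solves (C ∪ C') ↔ φ.Solves C ∧ φ.Solves C' :=
  ⟨fun h => ⟨fun κ hκ => h κ (.inl hκ), fun κ hκ => h κ (.inr hκ)⟩,
    fun h κ hκ => hκ.elim (h.1 κ) (h.2 κ)⟩

theorem solves_singleton {κ : Constr} : φ.Solves {κ} ↔ κ.Sat φ := by
  simp [Solves]

theorem solves_pair {κ κ' : Constr} : φ.Solves {κ, κ'} ↔ κ.Sat φ ∧ κ'.Sat φ := by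
  simp [Solves]

theorem Solves.mono {C C' : Set Constr} (h : φ.Solves C') (hC : C ⊆ C') : φ.Solves C :=
  fun κ hκ => h κ (hC hκ)

theorem solves_admF {F : PF} : φ.Solves (admF F) ↔ φ.AdmF F := by
  induction F with
  | var i => simp [admF, AdmF, Solves]
  | arr b c F c' F' ih ih' =>
    simp only [admF, AdmF, solves_union, solves_pair, solves_singleton, Constr.Sat, ih, ih',
      and_assoc]
  | all c F ih => simp only [admF, AdmF, solves_union, solves_singleton, Constr.Sat, ih]

theorem solves_admLin {A : PLin} : φ.Solves (admLin A) ↔ φ.AdmLin A := by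
  simp only [admLin, AdmLin, solves_union, solves_singleton, Constr.Sat, solves_admF]

theorem solves_admBang {D : PBang} : φ.Solves (admBang D) ↔ φ.AdmBang D := by
  simp only [admBang, AdmBang, solves_union, solves_pair, Constr.Sat, solves_admF, and_assoc]

theorem onF_eq_of_solves {F F' : PF} (he : F.erase = F'.erase) (h : φ.Solves (unifF F F')) :
    φ.onF F = φ.onF F' := by
  induction F generalizing F' with
  | var i => cases F' <;> simp_all [PF.erase, onF]
  | arr b c F c' G ih ih' =>
    cases F' <;> simp only [PF.erase, reduceCtorEq, Ty.arr.injEq] at he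
    simp only [unifF, solves_union, solves_pair, solves_singleton, Constr.Sat] at h
    obtain ⟨⟨⟨hb, hc⟩, h₁⟩, hc', h₂⟩ := h
    simp only [onF, bangTy, hb, hc, hc', ih he.1 h₁, ih' he.2 h₂]
  | all c F ih =>
    cases F' <;> simp only [PF.erase, reduceCtorEq, Ty.all.injEq] at he
    simp only [unifF, solves_union, solves_singleton, Constr.Sat] at h
    simp only [onF, h.1, ih he h.2]

theorem onLin_eq_of_solves {A A' : PLin} (he : A.F.erase = A'.F.erase)
    (h : φ.Solves (unifLin A A')) : φ.onLin A = φ.onLin A' := by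
  simp only [unifLin, solves_union, solves_singleton, Constr.Sat] at h
  rw [onLin, onLin, h.1, onF_eq_of_solves he h.2]

theorem secs_eval_injective {c c' : Lin} {F F' : PF} (h : 0 ≤ φ.eval c) (h' : 0 ≤ φ.eval c')
    (e : LTy.secs (φ.eval c).toNat (φ.onF F) = LTy.secs (φ.eval c').toNat (φ.onF F')) :
    φ.eval c = φ.eval c' ∧ φ.onF F = φ.onF F' := by
  obtain ⟨h₁, h₂⟩ := LTy.secs_injective (φ.onF_ne_sec F) (φ.onF_ne_sec F') e
  exact ⟨by omega, h₂⟩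

/-- Instantiation is injective on admissible p-types: an equality between instances forces
the parameters at corresponding places to have equal values. -/
theorem solves_unifF {F F' : PF} (hF : φ.AdmF F) (hF' : φ.AdmF F') (e : φ.onF F = φ.onF F') :
    φ.Solves (unifF F F') := by
  induction F generalizing F' with
  | var i => cases F' <;> simp [unifF, Solves]
  | arr b c F c' G ih ih' =>
    cases F' with
    | var => simp [onF] at e
    | all => simp [onF] at e
    | arr b₁ c₁ F₁ c₁' G₁ =>
    simp only [onF, LTy.lolli.injEq, bang_bangTy] at e
    obtain ⟨h₁, h₂, h₃, h₄, h₅⟩ := hF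
    obtain ⟨h₁', h₂', h₃', h₄', h₅'⟩ := hF'
    obtain ⟨eb, e, e'⟩ := e
    obtain ⟨k₃, k₄⟩ := secs_eval_injective h₄ h₄' e'
    have e₁ := circ_bangTy h₂ (φ.onF F)
    have e₂ := circ_bangTy h₂' (φ.onF F₁)
    have : ∀ D D' : DTy, D.bang = D'.bang → D.ty = D'.ty → D.circ = D'.circ := by
      rintro ⟨_, _⟩ ⟨_, _⟩ rfl rfl
      rfl
    rw [this _ _ (by simpa [bang_bangTy] using eb) e, e₂] at e₁
    obtain ⟨k₁, k₂⟩ := secs_eval_injective h₁' h₁ e₁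
    simp only [unifF, solves_union, solves_pair, solves_singleton, Constr.Sat]
    exact ⟨⟨⟨eb, k₁.symm⟩, ih h₃ h₃' k₂.symm⟩, k₃, ih' h₅ h₅' k₄⟩
  | all c F ih =>
    cases F' <;> simp only [onF, reduceCtorEq, LTy.all.injEq] at e
    obtain ⟨k₁, k₂⟩ := secs_eval_injective hF.1 hF'.1 e
    simp only [unifF, solves_union, solves_singleton, Constr.Sat]
    exact ⟨k₁, ih hF.2 hF'.2 k₂⟩

theorem solves_unifLin {A A' : PLin} (hA : φ.AdmLin A) (hA' : φ.AdmLin A')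
    (e : φ.onLin A = φ.onLin A') : φ.Solves (unifLin A A') := by
  obtain ⟨k₁, k₂⟩ := secs_eval_injective hA.1 hA'.1 e
  simp only [unifLin, solves_union, solves_singleton, Constr.Sat]
  exact ⟨k₁, solves_unifF hA.2 hA'.2 k₂⟩

end Inst

/-! ### Occurrences -/

namespace Tm

variable {β α δ : Type}

/-- Number of nodes of a term. -/
def nodes : Tm β α δ → ℕ
  | var _ => 1
  | lam _ t => t.nodes + 1
  | app t u => t.nodes + u.nodes + 1
  | tlam t => t.nodes + 1
  | tapp t _ => t.nodes + 1
  | door _ t => t.nodes + 1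

/-- The root of the term is a door. -/
def IsDoor (t : Tm β α δ) : Prop := ∃ d w, t = door d w

/-- Doors and the other nodes alternate: the children of a node that is not a door are doors,
and the child of a door is not a door. -/
def Alternating : Tm β α δ → Prop
  | var _ => True
  | lam _ t => t.IsDoor ∧ t.Alternating
  | app t u => (t.IsDoor ∧ t.Alternating) ∧ u.IsDoor ∧ u.Alternating
  | tlam t => t.IsDoor ∧ t.Alternating
  | tapp t _ => t.IsDoor ∧ t.Alternating
  | door _ t => ¬ t.IsDoor ∧ t.Alternating

theorem exists_count_pos {up : β → β} {t : Tm β α δ} {i : ℕ} (h : 0 < t.count i) (Γ : List β) :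
    ∃ l k j Δ, Occ up Γ t l k j Δ (.var (i + k)) := by
  induction t generalizing i Γ with
  | var n =>
    have : i = n := by
      by_contra hne
      simp [count, hne] at h
    subst this
    exact ⟨_, _, _, _, .refl _ _⟩
  | lam D t ih =>
    obtain ⟨l, k, j, Δ, o⟩ := ih (i := i + 1) h (D :: Γ)
    exact ⟨l, k + 1, j, Δ, by simpa [Nat.add_assoc, Nat.add_comm 1] using o.lam⟩
  | app t u ih ih' =>
    simp only [count] at h
    by_cases ht : 0 < t.count i
    · obtain ⟨l, k, j, Δ, o⟩ := ih ht Γ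
      exact ⟨l, k, j, Δ, o.app_left⟩
    · obtain ⟨l, k, j, Δ, o⟩ := ih' (i := i) (by omega) Γ
      exact ⟨l, k, j, Δ, o.app_right⟩
  | tlam t ih =>
    obtain ⟨l, k, j, Δ, o⟩ := ih h (Γ.map up)
    exact ⟨l, k, j + 1, Δ, o.tlam⟩
  | tapp t A ih =>
    obtain ⟨l, k, j, Δ, o⟩ := ih h Γ
    exact ⟨l, k, j, Δ, o.tapp⟩
  | door d t ih =>
    obtain ⟨l, k, j, Δ, o⟩ := ih h Γ
    exact ⟨d :: l, k, j, Δ, o.door⟩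

theorem freeOcc_pos_of_occ {up : β → β} {Γ Δ : List β} {t : Tm β α δ} {l : List δ} {k j i n : ℕ}
    (o : Occ up Γ t l k j Δ (.var i)) (h : n + k ≤ i) : 0 < t.freeOcc n := by
  generalize hv : (Tm.var i : Tm β α δ) = v at o
  induction o generalizing n with
  | refl =>
    subst hv
    have : n ≤ i := by omega
    simp [freeOcc, this]
  | lam _ ih => exact ih (by omega) hv
  | app_left _ ih => have := ih h hv; simp only [freeOcc]; omega
  | app_right _ ih => have := ih h hv; simp only [freeOcc]; omega
  | tlam _ ih => exact ih h hv
  | tapp _ ih => exact ih h hv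
  | door _ ih => exact ih h hv

end Tm

namespace Occ

variable {β α δ : Type} {up : β → β} {Γ Δ Δ' : List β} {t u v : Tm β α δ} {l l' : List δ}
  {k k' j j' : ℕ}

theorem trans (h : Occ up Γ t l k j Δ u) (h' : Occ up Δ u l' k' j' Δ' v) :
    Occ up Γ t (l ++ l') (k' + k) (j' + j) Δ' v := by
  induction h with
  | refl => exact h'
  | lam _ ih => exact (ih h').lam
  | app_left _ ih => exact (ih h').app_left
  | app_right _ ih => exact (ih h').app_right
  | tlam _ ih => exact (ih h').tlam
  | tapp _ ih => exact (ih h').tapp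
  | door _ ih => exact (ih h').door

theorem nodes_lt_or_eq (h : Occ up Γ t l k j Δ u) : u.nodes < t.nodes ∨ u = t ∧ l = [] := by
  induction h with
  | refl => exact .inr ⟨rfl, rfl⟩
  | lam _ ih => left; rcases ih with ih | ⟨rfl, _⟩ <;> simp only [Tm.nodes] <;> omega
  | app_left _ ih => left; rcases ih with ih | ⟨rfl, _⟩ <;> simp only [Tm.nodes] <;> omega
  | app_right _ ih => left; rcases ih with ih | ⟨rfl, _⟩ <;> simp only [Tm.nodes] <;> omega
  | tlam _ ih => left; rcases ih with ih | ⟨rfl, _⟩ <;> simp only [Tm.nodes] <;> omega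
  | tapp _ ih => left; rcases ih with ih | ⟨rfl, _⟩ <;> simp only [Tm.nodes] <;> omega
  | door _ ih => left; rcases ih with ih | ⟨rfl, _⟩ <;> simp only [Tm.nodes] <;> omega

theorem nodes_le (h : Occ up Γ t l k j Δ u) : u.nodes ≤ t.nodes := by
  rcases h.nodes_lt_or_eq with h | ⟨rfl, _⟩
  · exact h.le
  · exact le_rfl

theorem eq_nil_of_self (h : Occ up Γ t l k j Δ t) : l = [] := by
  rcases h.nodes_lt_or_eq with h | ⟨_, h⟩
  · exact absurd h (lt_irrefl _)
  · exact h

theorem alternating (h : Occ up Γ t l k j Δ u) (ht : t.Alternating) : u.Alternating := by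
  induction h with
  | refl => exact ht
  | lam _ ih => exact ih ht.2
  | app_left _ ih => exact ih ht.1.2
  | app_right _ ih => exact ih ht.2.2
  | tlam _ ih => exact ih ht.2
  | tapp _ ih => exact ih ht.2
  | door _ ih => exact ih ht.2

/-- An occurrence is either the root or has a parent; the word of the parent is the same,
unless the parent is a door. -/
theorem parent (h : Occ up Γ t l k j Δ u) : (u = t ∧ l = []) ∨
    ∃ l₁ k₁ j₁ Δ₁ p, Occ up Γ t l₁ k₁ j₁ Δ₁ p ∧ (∀ i, p ≠ .var i) ∧
      (¬ p.IsDoor ∧ l = l₁ ∨ ∃ d, p = .door d u ∧ l = l₁ ++ [d]) := by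
  induction h with
  | refl => exact .inl ⟨rfl, rfl⟩
  | lam _ ih =>
    right
    rcases ih with ⟨rfl, rfl⟩ | ⟨l₁, k₁, j₁, Δ₁, p, o, hp, h⟩
    · exact ⟨_, _, _, _, _, .refl _ _, by simp, .inl ⟨by simp [Tm.IsDoor], rfl⟩⟩
    · exact ⟨_, _, _, _, _, o.lam, hp, h⟩
  | app_left _ ih =>
    right
    rcases ih with ⟨rfl, rfl⟩ | ⟨l₁, k₁, j₁, Δ₁, p, o, hp, h⟩
    · exact ⟨_, _, _, _, _, .refl _ _, by simp, .inl ⟨by simp [Tm.IsDoor], rfl⟩⟩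
    · exact ⟨_, _, _, _, _, o.app_left, hp, h⟩
  | app_right _ ih =>
    right
    rcases ih with ⟨rfl, rfl⟩ | ⟨l₁, k₁, j₁, Δ₁, p, o, hp, h⟩
    · exact ⟨_, _, _, _, _, .refl _ _, by simp, .inl ⟨by simp [Tm.IsDoor], rfl⟩⟩
    · exact ⟨_, _, _, _, _, o.app_right, hp, h⟩
  | tlam _ ih =>
    right
    rcases ih with ⟨rfl, rfl⟩ | ⟨l₁, k₁, j₁, Δ₁, p, o, hp, h⟩
    · exact ⟨_, _, _, _, _, .refl _ _, by simp, .inl ⟨by simp [Tm.IsDoor], rfl⟩⟩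
    · exact ⟨_, _, _, _, _, o.tlam, hp, h⟩
  | tapp _ ih =>
    right
    rcases ih with ⟨rfl, rfl⟩ | ⟨l₁, k₁, j₁, Δ₁, p, o, hp, h⟩
    · exact ⟨_, _, _, _, _, .refl _ _, by simp, .inl ⟨by simp [Tm.IsDoor], rfl⟩⟩
    · exact ⟨_, _, _, _, _, o.tapp, hp, h⟩
  | @door _ _ d _ _ _ _ _ _ ih =>
    right
    rcases ih with ⟨rfl, rfl⟩ | ⟨l₁, k₁, j₁, Δ₁, p, o, hp, h⟩
    · exact ⟨_, _, _, _, _, .refl _ _, by simp, .inr ⟨d, rfl, rfl⟩⟩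
    · refine ⟨_, _, _, _, _, o.door, hp, ?_⟩
      rcases h with ⟨h, rfl⟩ | ⟨d', h, rfl⟩
      · exact .inl ⟨h, rfl⟩
      · exact .inr ⟨d', h, rfl⟩

/-- The abstraction that binds the variable with index `i` at the occurrence `u`. -/
theorem exists_binder (h : Occ up Γ t l k j Δ u) {i : ℕ} (hi : i < k) :
    ∃ l₁ k₁ j₁ Δ₁ D v l₂ j₂, Occ up Γ t l₁ k₁ j₁ Δ₁ (.lam D v) ∧
      Occ up (D :: Δ₁) v l₂ i j₂ Δ u ∧ l = l₁ ++ l₂ := by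
  induction h with
  | refl => omega
  | lam o ih =>
    rcases Nat.lt_succ_iff_lt_or_eq.1 hi with hi | rfl
    · obtain ⟨l₁, k₁, j₁, Δ₁, D, v, l₂, j₂, o₁, o₂, rfl⟩ := ih hi
      exact ⟨_, _, _, _, _, _, _, _, o₁.lam, o₂, rfl⟩
    · exact ⟨_, _, _, _, _, _, _, _, .refl _ _, o, rfl⟩
  | app_left _ ih =>
    obtain ⟨l₁, k₁, j₁, Δ₁, D, v, l₂, j₂, o₁, o₂, rfl⟩ := ih hi
    exact ⟨_, _, _, _, _, _, _, _, o₁.app_left, o₂, rfl⟩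
  | app_right _ ih =>
    obtain ⟨l₁, k₁, j₁, Δ₁, D, v, l₂, j₂, o₁, o₂, rfl⟩ := ih hi
    exact ⟨_, _, _, _, _, _, _, _, o₁.app_right, o₂, rfl⟩
  | tlam _ ih =>
    obtain ⟨l₁, k₁, j₁, Δ₁, D, v, l₂, j₂, o₁, o₂, rfl⟩ := ih hi
    exact ⟨_, _, _, _, _, _, _, _, o₁.tlam, o₂, rfl⟩
  | tapp _ ih =>
    obtain ⟨l₁, k₁, j₁, Δ₁, D, v, l₂, j₂, o₁, o₂, rfl⟩ := ih hi
    exact ⟨_, _, _, _, _, _, _, _, o₁.tapp, o₂, rfl⟩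
  | door _ ih =>
    obtain ⟨l₁, k₁, j₁, Δ₁, D, v, l₂, j₂, o₁, o₂, rfl⟩ := ih hi
    exact ⟨_, _, _, _, _, _, _, _, o₁.door, o₂, rfl⟩

/-- The types of the variables that are free at the root are only renamed on the way down. -/
theorem context_getElem? (h : Occ up Γ t l k j Δ u) {i : ℕ} (hi : k ≤ i) :
    Δ[i]? = Γ[i - k]?.map up^[j] := by
  induction h generalizing i with
  | refl => simp
  | @lam Γ Δ D t u l k j _ ih =>
    rw [ih (by omega), show i - k = (i - (k + 1)) + 1 by omega, List.getElem?_cons_succ]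
  | app_left _ ih => exact ih hi
  | app_right _ ih => exact ih hi
  | tlam _ ih => rw [ih hi, List.getElem?_map, Option.map_map, Function.iterate_succ]
  | tapp _ ih => exact ih hi
  | door _ ih => exact ih hi

/-- Every prefix of the word of an occurrence is the word of an occurrence. -/
theorem exists_of_prefix (h : Occ up Γ t l k j Δ u) (hl : l' <+: l) :
    ∃ k' j' Δ' v, Occ up Γ t l' k' j' Δ' v := by
  induction h generalizing l' with
  | refl =>
    obtain rfl := List.prefix_nil.1 hl
    exact ⟨_, _, _, _, .refl _ _⟩
  | lam _ ih =>
    obtain ⟨_, _, _, _, o⟩ := ih hl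
    exact ⟨_, _, _, _, o.lam⟩
  | app_left _ ih =>
    obtain ⟨_, _, _, _, o⟩ := ih hl
    exact ⟨_, _, _, _, o.app_left⟩
  | app_right _ ih =>
    obtain ⟨_, _, _, _, o⟩ := ih hl
    exact ⟨_, _, _, _, o.app_right⟩
  | tlam _ ih =>
    obtain ⟨_, _, _, _, o⟩ := ih hl
    exact ⟨_, _, _, _, o.tlam⟩
  | tapp _ ih =>
    obtain ⟨_, _, _, _, o⟩ := ih hl
    exact ⟨_, _, _, _, o.tapp⟩
  | door _ ih =>
    rcases List.prefix_cons_iff.1 hl with rfl | ⟨l'', rfl, hl'⟩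
    · exact ⟨_, _, _, _, .refl _ _⟩
    · obtain ⟨_, _, _, _, o⟩ := ih hl'
      exact ⟨_, _, _, _, o.door⟩

end Occ

/-! ### Typing of pseudo-terms and of parameterized terms -/

theorem PsTm.HasTy.unique {Γ : List DTy} {t : PsTm} {A B : LTy} (h : HasTy Γ t A)
    (h' : HasTy Γ t B) : A = B := by
  induction h generalizing B with
  | var hi =>
    cases h' with
    | var hi' => rw [hi] at hi'; cases hi'; rfl
  | lam _ ih => cases h' with | lam h' => rw [ih h']
  | app _ _ _ ih _ => cases h' with | app h' _ _ => exact (LTy.lolli.inj (ih h')).2.2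
  | opn _ ih => cases h' with | opn h' => rw [ih h']
  | cls _ ih => cases h' with | cls h' => exact LTy.sec.inj (ih h')
  | tlam _ ih => cases h' with | tlam h' => rw [ih h']
  | tapp B _ ih => cases h' with | tapp _ h' => rw [LTy.all.inj (ih h')]

/-- The occurrence of a subterm in a typable pseudo-term is typable. -/
theorem PsTm.HasTy.of_occ {Γ Δ : List DTy} {t u : PsTm} {l : List Door} {k j : ℕ} {A : LTy}
    (h : HasTy Γ t A) (o : Occ DTy.up Γ t l k j Δ u) : ∃ B, HasTy Δ u B := by
  induction o generalizing A with
  | refl => exact ⟨A, h⟩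
  | lam _ ih => cases h with | lam h => exact ih h
  | app_left _ ih => cases h with | app h _ _ => exact ih h
  | app_right _ ih => cases h with | app _ h _ => exact ih h
  | tlam _ ih => cases h with | tlam h => exact ih h
  | tapp _ ih => cases h with | tapp _ h => exact ih h
  | door _ ih =>
    cases h with
    | opn h => exact ih h
    | cls h => exact ih h

namespace PTm.Typing

variable {P Δ : List PBang} {t u : PTm} {A A' : PLin} {C C' : Set Constr} {φ : Inst}

theorem unique (h : Typing P t A C) (h' : Typing P t A' C') : A = A' ∧ C = C' := by
  induction h generalizing A' C' with
  | var hi =>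
    cases h' with
    | var hi' => rw [hi] at hi'; cases hi'; exact ⟨rfl, rfl⟩
  | door _ ih =>
    cases h' with
    | door h' => obtain ⟨rfl, rfl⟩ := ih h'; exact ⟨rfl, rfl⟩
  | lam _ ih =>
    cases h' with
    | lam h' => obtain ⟨rfl, rfl⟩ := ih h'; exact ⟨rfl, rfl⟩
  | @app _ D _ _ _ _ B _ _ _ _ _ ih ih' =>
    cases h' with
    | @app _ D' _ _ _ _ _ _ _ h₁ h₂ _ =>
      obtain ⟨e, rfl⟩ := ih h₁
      obtain ⟨rfl, rfl⟩ := ih' h₂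
      obtain ⟨b, c, F⟩ := D
      obtain ⟨b', c', F'⟩ := D'
      obtain ⟨d, G⟩ := B
      obtain ⟨d', G'⟩ := A'
      simp only [PLin.mk.injEq, PF.arr.injEq] at e
      obtain ⟨rfl, rfl, rfl, rfl, rfl, rfl⟩ := e
      exact ⟨rfl, rfl⟩
  | tlam _ ih =>
    cases h' with
    | tlam h' => obtain ⟨rfl, rfl⟩ := ih h'; exact ⟨rfl, rfl⟩
  | @tapp _ _ _ _ B _ _ ih =>
    cases h' with
    | @tapp _ _ _ _ B' _ h' =>
      obtain ⟨e, rfl⟩ := ih h'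
      obtain ⟨d, G⟩ := B
      obtain ⟨d', G'⟩ := B'
      simp only [PLin.mk.injEq, PF.all.injEq] at e
      obtain ⟨rfl, rfl, rfl⟩ := e
      exact ⟨rfl, rfl⟩

theorem of_occ {l : List ℕ} {k j : ℕ} (h : Typing P t A C)
    (o : Occ PBang.up P t l k j Δ u) : ∃ A' C', Typing Δ u A' C' ∧ C' ⊆ C := by
  induction o generalizing A C with
  | refl => exact ⟨A, C, h, subset_rfl⟩
  | lam _ ih =>
    cases h with
    | lam h =>
      obtain ⟨A', C', h', hC⟩ := ih h
      exact ⟨A', C', h', fun _ hx => .inl (hC hx)⟩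
  | app_left _ ih =>
    cases h with
    | app h _ _ =>
      obtain ⟨A', C', h', hC⟩ := ih h
      exact ⟨A', C', h', fun _ hx => .inl (.inl (.inl (hC hx)))⟩
  | app_right _ ih =>
    cases h with
    | app _ h _ =>
      obtain ⟨A', C', h', hC⟩ := ih h
      exact ⟨A', C', h', fun _ hx => .inl (.inl (.inr (hC hx)))⟩
  | tlam _ ih => cases h with | tlam h => exact ih h
  | tapp _ ih =>
    cases h with
    | tapp h =>
      obtain ⟨A', C', h', hC⟩ := ih h
      exact ⟨A', C', h', fun _ hx => .inl (.inl (hC hx))⟩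
  | door _ ih =>
    cases h with
    | door h =>
      obtain ⟨A', C', h', hC⟩ := ih h
      exact ⟨A', C', h', fun _ hx => .inl (hC hx)⟩

/-- A solution of the typing constraints makes the output p-type admissible. -/
theorem admLin (h : Typing P t A C) (hs : φ.Solves C) : φ.AdmLin A := by
  induction h with
  | var _ =>
    have := Inst.solves_admBang.1 hs
    exact ⟨this.1, this.2.2⟩
  | door _ ih =>
    rw [Inst.solves_union, Inst.solves_singleton] at hs
    exact ⟨hs.2, (ih hs.1).2⟩
  | lam _ ih =>
    rw [Inst.solves_union, Inst.solves_admBang] at hs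
    obtain ⟨h₁, h₂, h₃, h₄⟩ := hs
    obtain ⟨h₅, h₆⟩ := ih h₁
    exact ⟨by simp, h₂, h₃, h₄, h₅, h₆⟩
  | app _ _ _ ih _ =>
    simp only [Inst.solves_union] at hs
    obtain ⟨_, _, _, _, h₁, h₂⟩ := ih hs.1.1.1
    exact ⟨h₁, h₂⟩
  | tlam _ ih => exact ⟨by simp, ih hs⟩
  | tapp _ ih =>
    simp only [Inst.solves_union, Inst.solves_admLin] at hs
    exact Inst.admLin_inst hs.2 (ih hs.1.1).2

end PTm.Typing

namespace Inst

/-- The kind of doors in `§^n`. -/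
def doorKind (n : ℤ) : Door := if 0 ≤ n then .opn else .cls

theorem secPow_eq (n : ℤ) (t : PsTm) : secPow n t = doors (doorKind n) n.natAbs t := by
  unfold secPow doorKind
  split
  · congr 1
    omega
  · congr 1
    omega

theorem hasTy_doors_opn {Γ : List DTy} {n : ℕ} {t : PsTm} {A : LTy} :
    PsTm.HasTy Γ (doors .opn n t) A ↔ ∃ B, PsTm.HasTy Γ t B ∧ A = LTy.secs n B := by
  induction n generalizing A with
  | zero => simp [doors, LTy.secs]
  | succ n ih =>
    constructor
    · intro h
      cases h with
      | opn h =>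
        obtain ⟨B, hB, rfl⟩ := ih.1 h
        exact ⟨B, hB, rfl⟩
    · rintro ⟨B, hB, rfl⟩
      exact .opn (ih.2 ⟨B, hB, rfl⟩)

theorem hasTy_doors_cls {Γ : List DTy} {n : ℕ} {t : PsTm} {A : LTy} :
    PsTm.HasTy Γ (doors .cls n t) A ↔ PsTm.HasTy Γ t (LTy.secs n A) := by
  induction n generalizing A with
  | zero => rfl
  | succ n ih =>
    constructor
    · intro h
      cases h with
      | cls h =>
        rw [ih, LTy.secs_sec] at h
        exact h
    · intro h
      refine .cls (ih.2 ?_)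
      rw [LTy.secs_sec]
      exact h

/-- Soundness of the typing constraints: for a solution `φ`, if `t : A` then `φ(t) : φ(A)`. -/
theorem hasTy_onTm {P : List PBang} {t : PTm} {A : PLin} {C : Set Constr} {φ : Inst}
    (h : PTm.Typing P t A C) (hs : φ.Solves C) :
    PsTm.HasTy (P.map φ.onBang) (φ.onTm t) (φ.onLin A) := by
  induction h with
  | @var P i D hi =>
    rw [← circ_onBang (solves_admBang.1 hs)]
    exact .var (by simp [hi])
  | @door P m t A C h ih =>
    rw [solves_union, solves_singleton] at hs
    have hA := (h.admLin hs.1).1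
    have hm : 0 ≤ φ.int m + φ.eval A.c := by
      have := hs.2
      rwa [Constr.Sat, eval_add, eval_singleton] at this
    have ih := ih hs.1
    rw [onLin] at ih
    simp only [onTm, onLin, eval_add, eval_singleton]
    rw [secPow]
    split
    next h0 =>
      rw [hasTy_doors_opn]
      exact ⟨_, ih, by rw [← LTy.secs_add, Int.toNat_add h0 hA]⟩
    next h0 =>
      rw [hasTy_doors_cls, ← LTy.secs_add]
      convert ih using 2
      omega
  | @lam P D t A C _ ih =>
    rw [solves_union] at hs
    have := ih hs.1
    simp only [onLin, onF, eval_zero, Int.toNat_zero, LTy.secs]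
    exact .lam this
  | @app P D t u c A B C₁ C₂ h₁ h₂ he ih ih' =>
    simp only [solves_union, solves_singleton, Constr.Sat, eval_zero] at hs
    obtain ⟨⟨⟨hs₁, hs₂⟩, hc⟩, hu⟩ := hs
    have i₁ := ih hs₁
    have hD : φ.AdmBang D := by
      obtain ⟨_, a, b, c, _, _⟩ := h₁.admLin hs₁
      exact ⟨a, b, c⟩
    rw [onLin, hc] at i₁
    refine .app (D := φ.onBang D) i₁ (ih' hs₂) ?_
    rw [circ_onBang hD, onLin_eq_of_solves he hu]
  | @tlam P t A C h ih =>
    have := ih hs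
    rw [map_onBang_up] at this
    simp only [onLin, onF, eval_zero, Int.toNat_zero, LTy.secs]
    exact .tlam this
  | @tapp P t c A B C h ih =>
    simp only [solves_union, solves_singleton, solves_admLin, Constr.Sat, eval_zero] at hs
    obtain ⟨⟨hs, hc⟩, hA⟩ := hs
    have i := ih hs
    rw [onLin_inst hA (h.admLin hs).2]
    rw [onLin, hc] at i
    exact .tapp _ i

/-! ### Transfer of occurrences along an instantiation -/

/-- The word of doors into which a word of parameters is instantiated. -/
def expand (φ : Inst) (l : List ℕ) : List Door :=
  l.flatMap fun m => List.replicate (φ.int m).natAbs (doorKind (φ.int m))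

variable {φ : Inst}

theorem s_append (l l' : List Door) : PsTm.s (l ++ l') = PsTm.s l + PsTm.s l' := by
  induction l with
  | nil => simp [PsTm.s]
  | cons d l ih => cases d <;> simp [PsTm.s, ih] <;> ring

theorem s_replicate (n : ℕ) (d : Door) : PsTm.s (List.replicate n d) = n * PsTm.s [d] := by
  induction n with
  | zero => simp [PsTm.s]
  | succ n ih =>
    rw [List.replicate_succ, ← List.singleton_append, s_append, ih]
    push_cast
    ring

theorem s_doorKind (n : ℤ) : PsTm.s [doorKind n] = if 0 ≤ n then 1 else -1 := by
  unfold doorKind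
  split <;> simp [PsTm.s]

theorem s_expand (l : List ℕ) : PsTm.s (φ.expand l) = φ.eval (l : Multiset ℕ) := by
  induction l with
  | nil => simp [expand, PsTm.s]
  | cons m l ih =>
    have : φ.expand (m :: l)
        = List.replicate (φ.int m).natAbs (doorKind (φ.int m)) ++ φ.expand l := rfl
    rw [this, s_append, ih, s_replicate, s_doorKind, ← Multiset.cons_coe,
      ← Multiset.singleton_add, eval_add, eval_singleton]
    split <;> omega

theorem expand_append (l l' : List ℕ) : φ.expand (l ++ l') = φ.expand l ++ φ.expand l' := by
  simp [expand]

theorem expand_singleton (m : ℕ) :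
    φ.expand [m] = List.replicate (φ.int m).natAbs (doorKind (φ.int m)) := by
  simp [expand]

theorem eval_append_singleton (l : List ℕ) (m : ℕ) :
    φ.eval ((l ++ [m] : List ℕ) : Multiset ℕ) = φ.eval (l : Multiset ℕ) + φ.int m := by
  rw [← Multiset.coe_add, eval_add, Multiset.coe_singleton, eval_singleton]

theorem expand_prefix {l l' : List ℕ} (h : l' <+: l) : φ.expand l' <+: φ.expand l := by
  obtain ⟨r, rfl⟩ := h
  exact ⟨φ.expand r, (expand_append _ _).symm⟩

theorem eval_nonneg_of_prefix {l : List ℕ} (h : φ.Solves (PTm.wbracket l)) {l' : List ℕ}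
    (h' : l' <+: l) : 0 ≤ φ.eval (l' : Multiset ℕ) :=
  h _ ⟨l', h', rfl⟩

/-- The heights of the prefixes of an instantiated word lie between the heights at the
ends of the blocks of doors coming from single parameters. -/
theorem weaklyWellBracketed_expand {l : List ℕ} :
    PsTm.WeaklyWellBracketed (φ.expand l) ↔ φ.Solves (PTm.wbracket l) := by
  constructor
  · rintro h _ ⟨l', hl', rfl⟩
    have := h _ (expand_prefix hl')
    rwa [s_expand] at this
  · induction l using List.reverseRecOn with
    | nil =>
      intro _ l' hl'
      obtain rfl := List.prefix_nil.1 hl'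
      exact le_rfl
    | append_singleton l m ih =>
      intro h l' hl'
      rw [expand_append, expand_singleton] at hl'
      rcases List.prefix_or_prefix_of_prefix hl' (List.prefix_append _ _) with hl' | ⟨r, rfl⟩
      · exact ih (fun κ ⟨l₁, h₁, e⟩ => h κ ⟨l₁, h₁.trans (List.prefix_append _ _), e⟩) l' hl'
      · obtain ⟨hr₁, hr₂⟩ :=
          List.prefix_replicate_iff.1 ((List.prefix_append_right_inj _).1 hl')
        rw [hr₂, s_append, s_expand, s_replicate, s_doorKind]
        have h₁ := eval_nonneg_of_prefix h (List.prefix_append l [m])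
        have h₂ := eval_nonneg_of_prefix h (List.prefix_refl _)
        rw [eval_append_singleton] at h₂
        split <;> omega

theorem wellBracketed_expand {l : List ℕ} :
    PsTm.WellBracketed (φ.expand l) ↔ φ.Solves (PTm.bracket l) := by
  rw [PTm.bracket, solves_union, solves_singleton, PsTm.WellBracketed,
    weaklyWellBracketed_expand, s_expand, Constr.Sat, eval_zero]

theorem occ_doors {Γ Δ : List DTy} {t u : PsTm} {l : List Door} {k j : ℕ} (d : Door) (n : ℕ)
    (o : Occ DTy.up Γ t l k j Δ u) :
    Occ DTy.up Γ (doors d n t) (List.replicate n d ++ l) k j Δ u := by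
  induction n with
  | zero => exact o
  | succ n ih => exact ih.door

theorem of_occ_doors {Γ Δ : List DTy} {t v : PsTm} {l : List Door} {k j n : ℕ} {d : Door}
    (o : Occ DTy.up Γ (doors d n t) l k j Δ v) :
    (∃ a < n, l = List.replicate a d ∧ k = 0 ∧ j = 0 ∧ Δ = Γ ∧ v = doors d (n - a) t) ∨
    ∃ l', l = List.replicate n d ++ l' ∧ Occ DTy.up Γ t l' k j Δ v := by
  induction n generalizing l with
  | zero => exact .inr ⟨l, rfl, o⟩
  | succ n ih =>
    cases o with
    | refl => exact .inl ⟨0, by omega, rfl, rfl, rfl, rfl, rfl⟩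
    | door o =>
      rcases ih o with ⟨a, ha, rfl, h⟩ | ⟨l', rfl, o'⟩
      · refine .inl ⟨a + 1, by omega, rfl, ?_⟩
        rwa [Nat.succ_sub_succ]
      · exact .inr ⟨l', rfl, o'⟩

theorem occ_onTm {P Δ : List PBang} {t v : PTm} {l : List ℕ} {k j : ℕ}
    (o : Occ PBang.up P t l k j Δ v) :
    Occ DTy.up (P.map φ.onBang) (φ.onTm t) (φ.expand l) k j (Δ.map φ.onBang) (φ.onTm v) := by
  induction o with
  | refl => exact .refl _ _
  | lam _ ih => exact ih.lam
  | app_left _ ih => exact ih.app_left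
  | app_right _ ih => exact ih.app_right
  | tlam _ ih =>
    rw [map_onBang_up] at ih
    exact ih.tlam
  | tapp _ ih => exact ih.tapp
  | door _ ih =>
    rw [onTm, secPow_eq]
    exact occ_doors _ _ ih

/-- The occurrence `v` in `φ(t)` with word `l` comes from the p-term `t`: it is
either the instance of a subterm that is not a door, or it lies inside the block of doors into
which a door of `t` is instantiated. -/
inductive Origin (φ : Inst) (P : List PBang) (t : PTm) (k j : ℕ) (Δ : List PBang) :
    List Door → PsTm → Prop
  | node {l : List ℕ} {v : PTm} : Occ PBang.up P t l k j Δ v → ¬ v.IsDoor →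
      Origin φ P t k j Δ (φ.expand l) (φ.onTm v)
  | door {l : List ℕ} {m : ℕ} {w : PTm} {a : ℕ} : Occ PBang.up P t l k j Δ (.door m w) →
      a < (φ.int m).natAbs →
      Origin φ P t k j Δ (φ.expand l ++ List.replicate a (doorKind (φ.int m)))
        (doors (doorKind (φ.int m)) ((φ.int m).natAbs - a) (φ.onTm w))

theorem Origin.map {P P' Δ : List PBang} {t t' : PTm} {k k' j j' : ℕ} {r : List ℕ}
    (h : ∀ {l v}, Occ PBang.up P t l k j Δ v → Occ PBang.up P' t' (r ++ l) k' j' Δ v)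
    {l : List Door} {v : PsTm} (o : Origin φ P t k j Δ l v) :
    Origin φ P' t' k' j' Δ (φ.expand r ++ l) v := by
  cases o with
  | node o hv =>
    rw [← expand_append]
    exact .node (h o) hv
  | door o ha =>
    rw [← List.append_assoc, ← expand_append]
    exact .door (h o) ha

theorem exists_origin {P : List PBang} {t : PTm} {Δ : List DTy} {l : List Door} {k j : ℕ}
    {v : PsTm} (o : Occ DTy.up (P.map φ.onBang) (φ.onTm t) l k j Δ v) :
    ∃ Δ₀, Δ = Δ₀.map φ.onBang ∧ Origin φ P t k j Δ₀ l v := by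
  induction t generalizing P l k j with
  | var i =>
    cases o with
    | refl => exact ⟨P, rfl, .node (.refl _ _) (by simp [Tm.IsDoor])⟩
  | lam D t ih =>
    cases o with
    | refl => exact ⟨P, rfl, .node (.refl _ _) (by simp [Tm.IsDoor])⟩
    | lam o =>
      obtain ⟨Δ₀, rfl, h⟩ := ih (P := D :: P) o
      exact ⟨Δ₀, rfl, h.map (r := []) .lam⟩
  | app t u ih ih' =>
    cases o with
    | refl => exact ⟨P, rfl, .node (.refl _ _) (by simp [Tm.IsDoor])⟩
    | app_left o =>
      obtain ⟨Δ₀, rfl, h⟩ := ih o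
      exact ⟨Δ₀, rfl, h.map (r := []) .app_left⟩
    | app_right o =>
      obtain ⟨Δ₀, rfl, h⟩ := ih' o
      exact ⟨Δ₀, rfl, h.map (r := []) .app_right⟩
  | tlam t ih =>
    cases o with
    | refl => exact ⟨P, rfl, .node (.refl _ _) (by simp [Tm.IsDoor])⟩
    | tlam o =>
      rw [← map_onBang_up] at o
      obtain ⟨Δ₀, rfl, h⟩ := ih o
      exact ⟨Δ₀, rfl, h.map (r := []) .tlam⟩
  | tapp t A ih =>
    cases o with
    | refl => exact ⟨P, rfl, .node (.refl _ _) (by simp [Tm.IsDoor])⟩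
    | tapp o =>
      obtain ⟨Δ₀, rfl, h⟩ := ih o
      exact ⟨Δ₀, rfl, h.map (r := []) .tapp⟩
  | door m t ih =>
    rw [onTm, secPow_eq] at o
    rcases of_occ_doors o with ⟨a, ha, rfl, rfl, rfl, rfl, rfl⟩ | ⟨l', rfl, o'⟩
    · exact ⟨P, rfl, .door (l := []) (.refl _ _) ha⟩
    · obtain ⟨Δ₀, rfl, h⟩ := ih o'
      refine ⟨Δ₀, rfl, ?_⟩
      rw [← expand_singleton]
      exact h.map (r := [m]) .door

theorem not_isDoor_onTm {t : PTm} (h : ¬ t.IsDoor) : ¬ (φ.onTm t).IsDoor := by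
  cases t <;> simp_all [onTm, Tm.IsDoor]

theorem isDoor_doors {d : Door} {n : ℕ} (hn : 0 < n) (t : PsTm) : (doors d n t).IsDoor := by
  cases n with
  | zero => omega
  | succ n => exact ⟨_, _, rfl⟩

/-- An occurrence of a term whose root is not a door is the instance of an occurrence. -/
theorem exists_occ_of_not_isDoor {P : List PBang} {t : PTm} {Δ : List DTy} {l : List Door}
    {k j : ℕ} {v : PsTm} (o : Occ DTy.up (P.map φ.onBang) (φ.onTm t) l k j Δ v)
    (hv : ¬ v.IsDoor) : ∃ Δ₀ l₀ v₀, Δ = Δ₀.map φ.onBang ∧ l = φ.expand l₀ ∧ v = φ.onTm v₀ ∧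
      ¬ v₀.IsDoor ∧ Occ PBang.up P t l₀ k j Δ₀ v₀ := by
  obtain ⟨Δ₀, rfl, h⟩ := exists_origin o
  cases h with
  | node o' hv' => exact ⟨Δ₀, _, _, rfl, rfl, rfl, hv', o'⟩
  | door _ ha => exact absurd (isDoor_doors (by omega) _) hv

theorem onTm_eq_var {t : PTm} (h : ¬ t.IsDoor) {i : ℕ} (e : Tm.var i = φ.onTm t) :
    t = .var i := by
  cases t with
  | door => exact absurd ⟨_, _, rfl⟩ h
  | _ => simp_all [onTm]

theorem onTm_eq_lam {t : PTm} (h : ¬ t.IsDoor) {D : DTy} {v : PsTm}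
    (e : Tm.lam D v = φ.onTm t) : ∃ D₀ v₀, t = .lam D₀ v₀ ∧ D = φ.onBang D₀ ∧ v = φ.onTm v₀ := by
  cases t with
  | door => exact absurd ⟨_, _, rfl⟩ h
  | _ => simp_all [onTm]

theorem onTm_eq_app {t : PTm} (h : ¬ t.IsDoor) {v w : PsTm}
    (e : Tm.app v w = φ.onTm t) : ∃ v₀ w₀, t = .app v₀ w₀ ∧ v = φ.onTm v₀ ∧ w = φ.onTm w₀ := by
  cases t with
  | door => exact absurd ⟨_, _, rfl⟩ h
  | _ => simp_all [onTm]

theorem onTm_eq_tlam {t : PTm} (h : ¬ t.IsDoor) {v : PsTm}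
    (e : Tm.tlam v = φ.onTm t) : ∃ v₀, t = .tlam v₀ ∧ v = φ.onTm v₀ := by
  cases t with
  | door => exact absurd ⟨_, _, rfl⟩ h
  | _ => simp_all [onTm]

theorem occ_var {P : List PBang} {t : PTm} {Δ : List DTy} {l : List Door} {k j i : ℕ}
    (o : Occ DTy.up (P.map φ.onBang) (φ.onTm t) l k j Δ (.var i)) :
    ∃ Δ₀ l₀, Δ = Δ₀.map φ.onBang ∧ l = φ.expand l₀ ∧ Occ PBang.up P t l₀ k j Δ₀ (.var i) := by
  obtain ⟨Δ₀, l₀, v₀, rfl, rfl, e, h, o'⟩ := exists_occ_of_not_isDoor o (by simp [Tm.IsDoor])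
  rw [onTm_eq_var h e] at o'
  exact ⟨_, _, rfl, rfl, o'⟩

theorem occ_lam {P : List PBang} {t : PTm} {Δ : List DTy} {l : List Door} {k j : ℕ} {D : DTy}
    {v : PsTm} (o : Occ DTy.up (P.map φ.onBang) (φ.onTm t) l k j Δ (.lam D v)) :
    ∃ Δ₀ l₀ D₀ v₀, Δ = Δ₀.map φ.onBang ∧ l = φ.expand l₀ ∧ D = φ.onBang D₀ ∧ v = φ.onTm v₀ ∧
      Occ PBang.up P t l₀ k j Δ₀ (.lam D₀ v₀) := by
  obtain ⟨Δ₀, l₀, v₀, rfl, rfl, e, h, o'⟩ := exists_occ_of_not_isDoor o (by simp [Tm.IsDoor])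
  obtain ⟨D₀, v₀, rfl, rfl, rfl⟩ := onTm_eq_lam h e
  exact ⟨_, _, _, _, rfl, rfl, rfl, rfl, o'⟩

theorem occ_app {P : List PBang} {t : PTm} {Δ : List DTy} {l : List Door} {k j : ℕ}
    {v w : PsTm} (o : Occ DTy.up (P.map φ.onBang) (φ.onTm t) l k j Δ (.app v w)) :
    ∃ Δ₀ l₀ v₀ w₀, Δ = Δ₀.map φ.onBang ∧ l = φ.expand l₀ ∧ v = φ.onTm v₀ ∧ w = φ.onTm w₀ ∧
      Occ PBang.up P t l₀ k j Δ₀ (.app v₀ w₀) := by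
  obtain ⟨Δ₀, l₀, v₀, rfl, rfl, e, h, o'⟩ := exists_occ_of_not_isDoor o (by simp [Tm.IsDoor])
  obtain ⟨v₀, w₀, rfl, rfl, rfl⟩ := onTm_eq_app h e
  exact ⟨_, _, _, _, rfl, rfl, rfl, rfl, o'⟩

theorem occ_tlam {P : List PBang} {t : PTm} {Δ : List DTy} {l : List Door} {k j : ℕ}
    {v : PsTm} (o : Occ DTy.up (P.map φ.onBang) (φ.onTm t) l k j Δ (.tlam v)) :
    ∃ Δ₀ l₀ v₀, Δ = Δ₀.map φ.onBang ∧ l = φ.expand l₀ ∧ v = φ.onTm v₀ ∧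
      Occ PBang.up P t l₀ k j Δ₀ (.tlam v₀) := by
  obtain ⟨Δ₀, l₀, v₀, rfl, rfl, e, h, o'⟩ := exists_occ_of_not_isDoor o (by simp [Tm.IsDoor])
  obtain ⟨v₀, rfl, rfl⟩ := onTm_eq_tlam h e
  exact ⟨_, _, _, rfl, rfl, rfl, o'⟩

theorem count_doors (d : Door) (n : ℕ) (t : PsTm) (i : ℕ) :
    (doors d n t).count i = t.count i := by
  induction n with
  | zero => rfl
  | succ n ih => exact ih

theorem freeOcc_doors (d : Door) (n : ℕ) (t : PsTm) (i : ℕ) :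
    (doors d n t).freeOcc i = t.freeOcc i := by
  induction n with
  | zero => rfl
  | succ n ih => exact ih

theorem count_onTm (t : PTm) (i : ℕ) : (φ.onTm t).count i = t.count i := by
  induction t generalizing i <;> simp_all [onTm, Tm.count, secPow_eq, count_doors]

theorem freeOcc_onTm (t : PTm) (i : ℕ) : (φ.onTm t).freeOcc i = t.freeOcc i := by
  induction t generalizing i <;> simp_all [onTm, Tm.freeOcc, secPow_eq, freeOcc_doors]

end Inst

/-! ### Decorations of system F terms are typable -/

namespace PF

theorem erase_rename (ρ : ℕ → ℕ) (F : PF) : (F.rename ρ).erase = F.erase.rename ρ := by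
  induction F generalizing ρ with
  | var i => rfl
  | arr b c F c' F' ih ih' => simp [rename, erase, Ty.rename, ih, ih']
  | all c F ih => simp [rename, erase, Ty.rename, ih]

theorem erase_subst (σ : ℕ → PLin) (F : PF) :
    (F.subst σ).F.erase = F.erase.subst fun i => (σ i).F.erase := by
  induction F generalizing σ with
  | var i => rfl
  | arr b c F c' F' ih ih' => simp [subst, erase, Ty.subst, ih, ih']
  | all c F ih =>
    simp only [subst, erase, Ty.subst, ih]
    congr 2
    funext i
    cases i with
    | zero => rfl
    | succ i => simp [upSub, Ty.upSub, up, Ty.up, erase_rename]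

end PF

theorem PLin.erase_inst (B A : PLin) : (B.inst A).F.erase = B.F.erase.inst A.F.erase := by
  rw [inst_eq, PF.erase_subst, Ty.inst]
  congr 1
  funext i
  cases i <;> rfl

/-- The system F types underlying the p-types of a p-context. -/
def eraseCtx (P : List PBang) : List Ty := P.map fun D => D.F.erase

theorem eraseCtx_up (P : List PBang) :
    eraseCtx (P.map PBang.up) = (eraseCtx P).map Ty.up := by
  simp [eraseCtx, Function.comp_def, PBang.up, PF.up, Ty.up, PF.erase_rename]

theorem IsFreeDecoration.eraseCtx_eq {Γ : List Ty} {M : FTm} {P : List PBang} {t : PTm}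
    (h : IsFreeDecoration Γ M P t) : eraseCtx P = Γ := by
  have := h.ctx
  clear h
  induction this with
  | nil => rfl
  | cons h _ ih => rw [← ih, ← h.1]; rfl

theorem Lifts.isDoor_alternating {M : FTm} {t : PTm} (h : Lifts M t) :
    t.IsDoor ∧ t.Alternating := by
  induction h with
  | var m i => exact ⟨⟨_, _, rfl⟩, by simp [Tm.IsDoor], trivial⟩
  | lam m _ _ ih => exact ⟨⟨_, _, rfl⟩, by simp [Tm.IsDoor], ih⟩
  | app m _ _ ih ih' => exact ⟨⟨_, _, rfl⟩, by simp [Tm.IsDoor], ih, ih'⟩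
  | tlam m _ ih => exact ⟨⟨_, _, rfl⟩, by simp [Tm.IsDoor], ih⟩
  | tapp m _ _ ih => exact ⟨⟨_, _, rfl⟩, by simp [Tm.IsDoor], ih⟩

theorem FTm.HasTy.exists_typing {P : List PBang} {M : FTm} {T : Ty} {t : PTm}
    (h : FTm.HasTy (eraseCtx P) M T) (ht : Lifts M t) :
    ∃ A C, PTm.Typing P t A C ∧ A.F.erase = T := by
  generalize hΓ : eraseCtx P = Γ at h
  induction h generalizing P t with
  | @var Γ i T hi =>
    cases ht
    subst hΓ
    obtain ⟨D, hD, rfl⟩ : ∃ D, P[i]? = some D ∧ D.F.erase = T := by simpa [eraseCtx] using hi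
    exact ⟨_, _, .door (.var hD), rfl⟩
  | lam _ ih =>
    cases ht with
    | @lam _ _ D _ _ hD ht =>
      obtain ⟨A, C, h, rfl⟩ := ih (P := D :: P) ht (by rw [← hΓ, ← hD.1]; rfl)
      exact ⟨_, _, .door (.lam h), by rw [← hD.1]; rfl⟩
  | app _ _ ih ih' =>
    cases ht with
    | app _ ht hu =>
      obtain ⟨⟨c, F⟩, C, h, he⟩ := ih ht hΓ
      obtain ⟨A, C', h', he'⟩ := ih' hu hΓ
      cases F with
      | var => cases he
      | all => cases he
      | arr b d F d' F' =>
        obtain ⟨rfl, rfl⟩ := Ty.arr.inj he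
        exact ⟨_, _, .door (.app (D := ⟨b, d, F⟩) (B := ⟨d', F'⟩) h h' he'.symm), rfl⟩
  | tlam _ ih =>
    cases ht with
    | tlam _ ht =>
      obtain ⟨A, C, h, rfl⟩ := ih ht (by rw [eraseCtx_up, hΓ])
      exact ⟨_, _, .door (.tlam h), rfl⟩
  | tapp _ _ ih =>
    cases ht with
    | @tapp _ _ A _ _ hA ht =>
      obtain ⟨⟨c, F⟩, C, h, he⟩ := ih ht hΓ
      cases F with
      | var => cases he
      | arr => cases he
      | all d F =>
        obtain rfl := Ty.all.inj he
        exact ⟨_, _, .door (.tapp (B := ⟨d, F⟩) h), by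
          rw [← hA.1]
          exact PLin.erase_inst _ _⟩

/-! ### Typing constraints and local typing -/

namespace Inst.Admissible

variable {φ : Inst} {P : List PBang} {t u : PTm} {D : PBang} {A : PLin} {m : ℕ}

theorem of_lam (h : φ.Admissible P (.lam D t)) : φ.AdmBang D ∧ φ.Admissible (D :: P) t := by
  have hD := h.lam _ _ _ _ _ _ (.refl _ _)
  refine ⟨hD, ?_, fun _ _ _ _ _ _ o => h.lam _ _ _ _ _ _ o.lam,
    fun _ _ _ _ _ _ o => h.tapp _ _ _ _ _ _ o.lam⟩
  rintro (_ | i) E hi hE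
  · obtain rfl : D = E := by simpa using hE
    exact hD
  · exact h.free i E hi (by simpa using hE)

theorem of_app (h : φ.Admissible P (.app t u)) : φ.Admissible P t ∧ φ.Admissible P u :=
  ⟨⟨fun i E hi => h.free i E (Nat.add_pos_left hi _),
    fun _ _ _ _ _ _ o => h.lam _ _ _ _ _ _ o.app_left,
    fun _ _ _ _ _ _ o => h.tapp _ _ _ _ _ _ o.app_left⟩,
   ⟨fun i E hi => h.free i E (Nat.add_pos_right _ hi),
    fun _ _ _ _ _ _ o => h.lam _ _ _ _ _ _ o.app_right,
    fun _ _ _ _ _ _ o => h.tapp _ _ _ _ _ _ o.app_right⟩⟩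

theorem of_tlam (h : φ.Admissible P (.tlam t)) : φ.Admissible (P.map PBang.up) t := by
  refine ⟨fun i E hi hE => ?_, fun _ _ _ _ _ _ o => h.lam _ _ _ _ _ _ o.tlam,
    fun _ _ _ _ _ _ o => h.tapp _ _ _ _ _ _ o.tlam⟩
  rw [List.getElem?_map, Option.map_eq_some_iff] at hE
  obtain ⟨E, hE, rfl⟩ := hE
  exact admBang_up.2 (h.free i E hi hE)

theorem of_tapp (h : φ.Admissible P (.tapp t A)) : φ.AdmLin A ∧ φ.Admissible P t :=
  ⟨h.tapp _ _ _ _ _ _ (.refl _ _), fun i E hi => h.free i E hi,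
    fun _ _ _ _ _ _ o => h.lam _ _ _ _ _ _ o.tapp,
    fun _ _ _ _ _ _ o => h.tapp _ _ _ _ _ _ o.tapp⟩

theorem of_door (h : φ.Admissible P (.door m t)) : φ.Admissible P t :=
  ⟨fun i E hi => h.free i E hi,
    fun _ _ _ _ _ _ o => h.lam _ _ _ _ _ _ o.door,
    fun _ _ _ _ _ _ o => h.tapp _ _ _ _ _ _ o.door⟩

end Inst.Admissible

namespace PTm.Typing

variable {P Δ : List PBang} {t u : PTm} {A : PLin} {C : Set Constr} {φ : Inst}

theorem admissible (h : Typing P t A C) (hs : φ.Solves C) : φ.Admissible P t where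
  free i D hi hD := by
    obtain ⟨l, k, j, Δ, o⟩ := Tm.exists_count_pos (up := PBang.up) hi P
    obtain ⟨A', C', h', hC⟩ := h.of_occ o
    have hΔ := o.context_getElem? (i := i + k) (by omega)
    rw [Nat.add_sub_cancel, hD] at hΔ
    cases h' with
    | var hi' =>
      rw [hi'] at hΔ
      obtain rfl := Option.some.inj hΔ
      have := Inst.solves_admBang.1 (hs.mono hC)
      clear hΔ hC hi' o
      induction j with
      | zero => exact this
      | succ j ih =>
        rw [Function.iterate_succ_apply', Inst.admBang_up] at this
        exact ih this
  lam l k j Δ D v o := by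
    obtain ⟨A', C', h', hC⟩ := h.of_occ o
    cases h' with
    | lam _ =>
      have := hs.mono hC
      rw [Inst.solves_union, Inst.solves_admBang] at this
      exact this.2
  tapp l k j Δ v B o := by
    obtain ⟨A', C', h', hC⟩ := h.of_occ o
    cases h' with
    | tapp _ =>
      have := hs.mono hC
      rw [Inst.solves_union, Inst.solves_admLin] at this
      exact this.2

/-- The converse of `hasTy_onTm`: typability of the instance enforces the typing constraints. -/
theorem solves {B : LTy} (h : Typing P t A C) (ha : φ.Admissible P t)
    (ht : PsTm.HasTy (P.map φ.onBang) (φ.onTm t) B) : φ.Solves C := by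
  induction h generalizing B with
  | @var P i D hi =>
    exact Inst.solves_admBang.2 (ha.free i D (by simp [Tm.count]) hi)
  | @door P m t A C h ih =>
    rw [Inst.solves_union, Inst.solves_singleton]
    have hC : φ.Solves C := by
      rw [Inst.onTm, Inst.secPow_eq] at ht
      obtain ⟨B', hB'⟩ := ht.of_occ (Inst.occ_doors _ _ (.refl _ _))
      exact ih ha.of_door hB'
    refine ⟨hC, ?_⟩
    have hA := (h.admLin hC).1
    rw [Constr.Sat, Inst.eval_add, Inst.eval_singleton]
    rw [Inst.onTm, Inst.secPow] at ht
    split at ht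
    · omega
    · rw [Inst.hasTy_doors_cls] at ht
      have := LTy.le_of_secs_eq (φ.onF_ne_sec _) ((Inst.hasTy_onTm h hC).unique ht)
      omega
  | lam _ ih =>
    obtain ⟨h₁, h₂⟩ := ha.of_lam
    rw [Inst.solves_union, Inst.solves_admBang]
    cases ht with
    | lam ht => exact ⟨ih h₂ ht, h₁⟩
  | @app P D t u c A E C₁ C₂ h₁ h₂ he ih ih' =>
    obtain ⟨a₁, a₂⟩ := ha.of_app
    simp only [Inst.solves_union, Inst.solves_singleton, Constr.Sat, Inst.eval_zero]
    cases ht with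
    | @app _ D' _ _ A' _ t₁ t₂ e =>
      have s₁ := ih a₁ t₁
      have s₂ := ih' a₂ t₂
      have e₁ := (Inst.hasTy_onTm h₁ s₁).unique t₁
      have e₂ := (Inst.hasTy_onTm h₂ s₂).unique t₂
      have g₁ := h₁.admLin s₁
      obtain ⟨hc, hD₁, hD₂, hD₃, _, _⟩ := g₁
      have e₁' : LTy.secs (φ.eval c).toNat (φ.onF (.arr D.b D.c D.F E.c E.F))
        = LTy.secs 0 (.lolli D'.bang D'.ty B) := e₁
      obtain ⟨hc', e₃⟩ := LTy.secs_injective (φ.onF_ne_sec _) (by simp) e₁'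
      simp only [Inst.onF, LTy.lolli.injEq] at e₃
      have hDD : φ.onBang D = D' := by
        obtain ⟨b', A''⟩ := D'
        obtain ⟨rfl, rfl, -⟩ := e₃
        rfl
      refine ⟨⟨⟨s₁, s₂⟩, by simp only at hc; omega⟩, ?_⟩
      refine Inst.solves_unifLin ⟨hD₁, hD₃⟩ (h₂.admLin s₂) ?_
      rw [e₂, ← e, ← hDD, Inst.circ_onBang ⟨hD₁, hD₂, hD₃⟩]
  | tlam _ ih =>
    cases ht with
    | tlam ht =>
      rw [← Inst.map_onBang_up] at ht
      exact ih ha.of_tlam ht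
  | @tapp P t c A B C h ih =>
    obtain ⟨a₁, a₂⟩ := ha.of_tapp
    simp only [Inst.solves_union, Inst.solves_singleton, Constr.Sat, Inst.eval_zero,
      Inst.solves_admLin]
    cases ht with
    | @tapp _ _ A' _ ht =>
      have s := ih a₂ ht
      have e : LTy.secs (φ.eval c).toNat (φ.onF (.all B.c B.F)) = LTy.secs 0 (.all A') :=
        (Inst.hasTy_onTm h s).unique ht
      have hc := (h.admLin s).1
      obtain ⟨hc', -⟩ := LTy.secs_injective (φ.onF_ne_sec _) (by simp) e
      exact ⟨⟨s, by simp only at hc; omega⟩, a₁⟩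

/-- The typing constraints of a subterm are among those of the term. -/
theorem subset_of_occ {A' : PLin} {C' : Set Constr} {l : List ℕ} {k j : ℕ} (h : Typing P t A C)
    (o : Occ PBang.up P t l k j Δ u) (h' : Typing Δ u A' C') : C' ⊆ C := by
  obtain ⟨A'', C'', h'', hC⟩ := h.of_occ o
  obtain ⟨-, rfl⟩ := h'.unique h''
  exact hC

end PTm.Typing

/-- The eigenvariable condition is automatic: below `Λ α. u` the types of
the variables that are free in `Λ α. u` are weakened. -/
theorem not_hasFV_of_occ {Γ Δ : List DTy} {t u : PsTm} {l : List Door} {k j i : ℕ} {D : DTy}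
    (o : Occ DTy.up (Γ.map DTy.up) t l k j Δ u) (hi : k ≤ i) (hD : Δ[i]? = some D) :
    ¬ D.ty.HasFV j := by
  rw [o.context_getElem? hi, List.getElem?_map] at hD
  cases hE : Γ[i - k]? with
  | none => simp [hE] at hD
  | some E =>
    simp only [hE, Option.map_some, Option.some.injEq] at hD
    subst hD
    clear o hE
    induction j with
    | zero => exact LTy.not_hasFV_up_zero _
    | succ j ih =>
      rw [Function.iterate_succ_apply']
      exact fun h => ih (LTy.hasFV_up_succ.1 h)

namespace Inst

variable {φ : Inst} {P : List PBang} {t : PTm} {A : PLin} {C : Set Constr}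

theorem solves_of_solves_ltype (h : PTm.Typing P t A C) (hs : φ.Solves (PTm.ltype P t)) :
    φ.Solves C :=
  fun κ hκ => hs κ (.inl (.inl ⟨A, C, h, hκ⟩))

theorem localTyping_of_solves (h : PTm.Typing P t A C) (hs : φ.Solves (PTm.ltype P t)) :
    PsTm.LocalTyping (P.map φ.onBang) (φ.onTm t) where
  typed := ⟨_, hasTy_onTm h (solves_of_solves_ltype h hs)⟩
  contr_free i hi := by
    rw [count_onTm] at hi
    obtain ⟨l, k, j, Δ, o⟩ := Tm.exists_count_pos (up := PBang.up) (by omega : 0 < t.count i) P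
    obtain ⟨_, _, h', _⟩ := h.of_occ o
    have hΔ := o.context_getElem? (i := i + k) (by omega)
    cases h' with
    | var hi' =>
      rw [hi', Nat.add_sub_cancel] at hΔ
      cases hP : P[i]? with
      | none => simp [hP] at hΔ
      | some D =>
        refine ⟨φ.onBang D, by simp [hP], ?_⟩
        rw [onBang_bang]
        exact hs _ (.inl (.inr ⟨i, D, hP, hi, rfl⟩))
  contr_bound l k j Δ D v o hv := by
    obtain ⟨Δ, l, D, v, rfl, rfl, rfl, rfl, q⟩ := occ_lam o
    rw [count_onTm] at hv
    rw [onBang_bang]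
    exact hs _ (.inr ⟨l, k, j, Δ, D, v, q, hv, rfl⟩)
  eigenvariable _ _ _ _ _ _ _ _ _ _ _ o hi _ hD := not_hasFV_of_occ o hi hD

theorem solves_ltype (h : PTm.Typing P t A C) (ha : φ.Admissible P t)
    (ht : PsTm.LocalTyping (P.map φ.onBang) (φ.onTm t)) : φ.Solves (PTm.ltype P t) := by
  rintro κ ((⟨A', C', h', hκ⟩ | ⟨i, D, hD, hi, rfl⟩) | ⟨l, k, j, Δ, D, v, o, hv, rfl⟩)
  · obtain ⟨-, rfl⟩ := h.unique h'
    obtain ⟨B, hB⟩ := ht.typed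
    exact h.solves ha hB κ hκ
  · obtain ⟨E, hE, hb⟩ := ht.contr_free i (by rwa [count_onTm])
    rw [List.getElem?_map, hD] at hE
    obtain rfl := Option.some.inj hE
    rwa [onBang_bang] at hb
  · have := ht.contr_bound _ _ _ _ _ _ (occ_onTm o) (by rwa [count_onTm])
    rwa [onBang_bang] at this

/-! ### Bracketing and scope -/

theorem bracketing_iff : PsTm.Bracketing (P.map φ.onBang) (φ.onTm t) ↔
    φ.Solves (PTm.bracketing P t) := by
  constructor
  · rintro h κ ((⟨l, k, j, Δ, i, o, hi, hκ⟩ | ⟨l, k, j, Δ, D, v, o, hκ⟩) |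
      ⟨l, k, j, Δ, D, v, o, l', k', j', Δ', o', hκ⟩)
    · exact wellBracketed_expand.1 (h.free _ _ _ _ _ (occ_onTm o) hi) κ hκ
    · exact weaklyWellBracketed_expand.1 (h.abs _ _ _ _ _ _ (occ_onTm o)) κ hκ
    · exact wellBracketed_expand.1 (h.bound _ _ _ _ _ _ (occ_onTm o) _ _ _ _ (occ_onTm o')) κ hκ
  · intro h
    refine ⟨fun l k j Δ i o hi => ?_, fun l k j Δ D v o => ?_,
      fun l k j Δ D v o l' k' j' Δ' o' => ?_⟩
    · obtain ⟨Δ, l, rfl, rfl, q⟩ := occ_var o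
      exact wellBracketed_expand.2 fun κ hκ => h κ (.inl (.inl ⟨_, _, _, _, _, q, hi, hκ⟩))
    · obtain ⟨Δ, l, D, v, rfl, rfl, rfl, rfl, q⟩ := occ_lam o
      exact weaklyWellBracketed_expand.2 fun κ hκ => h κ (.inl (.inr ⟨_, _, _, _, _, _, q, hκ⟩))
    · obtain ⟨Δ, l, D, v, rfl, rfl, rfl, rfl, q⟩ := occ_lam o
      obtain ⟨Δ', l', rfl, rfl, q'⟩ := occ_var (P := D :: Δ) o'
      exact wellBracketed_expand.2 fun κ hκ =>
        h κ (.inr ⟨_, _, _, _, _, _, q, _, _, _, _, q', hκ⟩)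

/-- The doors above a term do not change the free type variables of its type. -/
theorem hasFV_of_hasTy_doors {Γ : List DTy} {d : Door} {n : ℕ} {t : PsTm} {A B : LTy} {i : ℕ}
    (h : PsTm.HasTy Γ (doors d n t) A) (h' : PsTm.HasTy Γ t B) (hA : A.HasFV i) :
    B.HasFV i := by
  cases d with
  | opn =>
    obtain ⟨B', hB', rfl⟩ := hasTy_doors_opn.1 h
    rw [h'.unique hB']
    exact LTy.hasFV_secs.1 hA
  | cls =>
    rw [hasTy_doors_cls] at h
    rw [h'.unique h]
    exact LTy.hasFV_secs.2 hA

theorem scope_iff (h : PTm.Typing P t A C) (hs : φ.Solves C) :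
    PsTm.Scope (P.map φ.onBang) (φ.onTm t) ↔ φ.Solves (PTm.scope P t) := by
  constructor
  · rintro hS κ ⟨l, k, j, Δ, u, o, l', k', j', Δ', v, B, C', o', h', hB, hκ⟩
    have o₂ := occ_onTm (φ := φ) o'
    rw [map_onBang_up] at o₂
    have hC' := h.subset_of_occ (o.trans (.tlam o')) h'
    exact weaklyWellBracketed_expand.1 (hS _ _ _ _ _ (occ_onTm o) _ _ _ _ _ _ o₂
      (hasTy_onTm h' (hs.mono hC')) ((hasFV_onLin _ _ _).2 hB)) κ hκ
  · intro hS l k j Δ u o l' k' j' Δ' v B o' hv hB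
    obtain ⟨Δ, l, u, rfl, rfl, rfl, q⟩ := occ_tlam o
    rw [← map_onBang_up] at o'
    obtain ⟨Δ', rfl, h'⟩ := exists_origin o'
    cases h' with
    | @node l' v q' _ =>
      obtain ⟨B', C', h', hC'⟩ := h.of_occ (q.trans (.tlam q'))
      rw [hv.unique (hasTy_onTm h' (hs.mono hC')), hasFV_onLin] at hB
      exact weaklyWellBracketed_expand.2 fun κ hκ =>
        hS κ ⟨_, _, _, _, _, q, _, _, _, _, _, _, _, q', h', hB, hκ⟩
    | @door l' m w a q' ha =>
      have ow : Occ PBang.up _ u (l' ++ [m]) _ _ _ w := q'.trans (.door (.refl _ _))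
      simp only [Nat.zero_add] at ow
      obtain ⟨B', C', h', hC'⟩ := h.of_occ (q.trans (.tlam ow))
      have hB' := hasFV_of_hasTy_doors hv (hasTy_onTm h' (hs.mono hC')) hB
      rw [hasFV_onLin] at hB'
      have hW : PsTm.WeaklyWellBracketed (φ.expand (l' ++ [m])) :=
        weaklyWellBracketed_expand.2 fun κ hκ =>
          hS κ ⟨_, _, _, _, _, q, _, _, _, _, _, _, _, ow, h', hB', hκ⟩
      refine fun l₁ hl₁ => hW l₁ (hl₁.trans ?_)
      rw [expand_append, expand_singleton, List.prefix_append_right_inj,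
        List.prefix_replicate_iff]
      simp [ha.le]

/-! ### Regularity -/

theorem regular_onTm (ht : t.Alternating) : PsTm.Regular (P.map φ.onBang) (φ.onTm t) := by
  have key : ∀ {l k j Δ d d' w}, d ≠ d' →
      ¬ Occ DTy.up (P.map φ.onBang) (φ.onTm t) l k j Δ (.door d (.door d' w)) := by
    intro l k j Δ d d' w hd o
    obtain ⟨Δ, rfl, h⟩ := exists_origin o
    generalize hv : Tm.door d (Tm.door d' w) = v at h
    cases h with
    | node _ hv' => exact not_isDoor_onTm hv' ⟨_, _, hv.symm⟩
    | @door l m w₀ a q ha =>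
      obtain ⟨n, hn⟩ : ∃ n, (φ.int m).natAbs - a = n + 1 :=
        ⟨(φ.int m).natAbs - a - 1, by omega⟩
      rw [hn] at hv
      obtain ⟨h₁, h₂⟩ := Tm.door.inj hv
      cases n with
      | zero => exact not_isDoor_onTm (q.alternating ht).1 ⟨_, _, h₂.symm⟩
      | succ n => exact hd (h₁.trans (Tm.door.inj h₂).1.symm)
  exact fun l k j Δ v w o =>
    ⟨by rintro rfl; exact key (by simp) o, by rintro rfl; exact key (by simp) o⟩

end Inst

/-! ### The bang condition -/

/-- All words in a bang subterm have nonnegative height: immediately below the root the word is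
empty or an opening door, and below a parent of height at least `1` at most one door is passed. -/
theorem PsTm.BangCond.s_nonneg {Γ Δ : List DTy} {u v : PsTm} {l : List Door} {k j : ℕ}
    (h : PsTm.BangCond Γ u) (o : Occ DTy.up Γ u l k j Δ v) : 0 ≤ PsTm.s l := by
  rcases o.parent with ⟨-, rfl⟩ | ⟨l₁, k₁, j₁, Δ₁, p, o', hp, hl⟩
  · exact le_rfl
  · by_cases hpu : p = u
    · subst hpu
      obtain rfl := o'.eq_nil_of_self
      rcases hl with ⟨-, rfl⟩ | ⟨d, hd, rfl⟩
      · exact le_rfl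
      · cases d with
        | opn => simp [PsTm.s]
        | cls => exact absurd hd (h.noClosing v)
    · have h₁ := h.inside _ _ _ _ _ o' hpu (by rintro ⟨i, -, hi⟩; exact hp i hi)
      rcases hl with ⟨-, rfl⟩ | ⟨d, -, rfl⟩
      · omega
      · rw [Inst.s_append]
        cases d <;> simp only [PsTm.s] <;> omega

namespace Inst

variable {φ : Inst} {P Δ : List PBang} {t u : PTm} {A : PLin} {C : Set Constr}

/-- The types of the two sides of an application in the instance of a p-term. -/
theorem hasTy_app (h : PTm.Typing Δ (.app t u) A C) (hs : φ.Solves C) :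
    ∃ (c : Lin) (D : PBang) (B : PLin) (C' : Set Constr),
      PTm.Typing Δ t ⟨c, .arr D.b D.c D.F B.c B.F⟩ C' ∧
      PsTm.HasTy (Δ.map φ.onBang) (φ.onTm t)
        (.lolli (φ.bool D.b) (φ.onBang D).ty (φ.onLin B)) ∧
      PsTm.HasTy (Δ.map φ.onBang) (φ.onTm u) (φ.onBang D).circ := by
  cases h with
  | @app _ D _ _ c A' _ C₁ C₂ h₁ h₂ he =>
    simp only [solves_union, solves_singleton, Constr.Sat, eval_zero] at hs
    obtain ⟨⟨⟨hs₁, hs₂⟩, hc⟩, hu⟩ := hs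
    obtain ⟨_, hD₁, hD₂, hD₃, _, _⟩ := h₁.admLin hs₁
    refine ⟨c, D, A, C₁, h₁, ?_, ?_⟩
    · have := hasTy_onTm h₁ hs₁
      rw [onLin, hc, ← onBang_bang] at *
      exact this
    · rw [circ_onBang ⟨hD₁, hD₂, hD₃⟩, onLin_eq_of_solves he hu]
      exact hasTy_onTm h₂ hs₂

theorem bool_eq_of_typing {c c' : Lin} {D D' : PBang} {B B' : PLin} {C C' : Set Constr}
    (h : PTm.Typing Δ t ⟨c, .arr D.b D.c D.F B.c B.F⟩ C)
    (h' : PTm.Typing Δ t ⟨c', .arr D'.b D'.c D'.F B'.c B'.F⟩ C') : D.b = D'.b := by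
  have := (h.unique h').1
  simp only [PLin.mk.injEq, PF.arr.injEq] at this
  exact this.2.1

/-- A bang subterm has a type `§ A`, so if no door is above its root then it is a variable:
an abstraction does not have such a type, an application would contain two free variables,
and a variable of a bang type cannot be applied to a type. -/
theorem exists_eq_var_of_bangCond {Γ : List DTy} {w : PsTm} {X : LTy}
    (hb : PsTm.BangCond Γ w) (hw : ¬ w.IsDoor) (ht : PsTm.HasTy Γ w (.sec X)) :
    ∃ i, w = .var i := by
  have child : ∀ {a : PsTm}, Occ DTy.up Γ w [] 0 0 Γ a → a ≠ w → ∃ i, a = .var i := by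
    intro a o ha
    by_contra hne
    have := hb.inside _ _ _ _ _ o ha (by rintro ⟨i, -, hi⟩; exact hne ⟨i, hi⟩)
    simp [PsTm.s] at this
  cases w with
  | var i => exact ⟨i, rfl⟩
  | lam D t => cases ht
  | tlam t => cases ht
  | door d t => exact absurd ⟨_, _, rfl⟩ hw
  | app a b =>
    obtain ⟨i, rfl⟩ := child (.app_left (.refl _ a)) (by
      intro e; have := congrArg Tm.nodes e; simp only [Tm.nodes] at this; omega)
    obtain ⟨i', rfl⟩ := child (.app_right (.refl _ b)) (by
      intro e; have := congrArg Tm.nodes e; simp only [Tm.nodes] at this; omega)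
    have := hb.one
    simp [Tm.freeOcc] at this
  | tapp a B =>
    obtain ⟨i, rfl⟩ := child (.tapp (.refl _ a)) (by
      intro e; have := congrArg Tm.nodes e; simp only [Tm.nodes] at this; omega)
    obtain ⟨D, hD, hDb⟩ := hb.bangVar _ _ _ _ _ (.tapp (.refl _ _)) (Nat.zero_le i)
    generalize hE : LTy.sec X = E at ht
    cases ht with
    | tapp _ ht =>
      generalize hG : LTy.all _ = G at ht
      cases ht with
      | var hi =>
        rw [hD] at hi
        obtain rfl := Option.some.inj hi
        simp [DTy.circ, hDb] at hG

/-- In a well-bracketed term the free variable of a bang subterm is at height at most that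
of the root of the subterm: its word from the binder is balanced and passes through the root. -/
theorem s_nonpos_of_bracketing {Γ Δ Δ' : List DTy} {t u : PsTm} {l l' : List Door}
    {k k' j j' i : ℕ} (hbr : PsTm.Bracketing Γ t) (o : Occ DTy.up Γ t l k j Δ u)
    (o' : Occ DTy.up Δ u l' k' j' Δ' (.var i)) (hi : k' ≤ i) : PsTm.s l' ≤ 0 := by
  have key : ∀ {r : List Door}, PsTm.WellBracketed (r ++ l') → PsTm.s l' ≤ 0 := by
    intro r h
    have h₁ := h.1 _ (List.prefix_append r l')
    have h₂ := h.2
    rw [s_append] at h₂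
    omega
  by_cases hf : k' + k ≤ i
  · exact key (hbr.free _ _ _ _ _ (o.trans o') hf)
  · obtain ⟨l₁, k₁, j₁, Δ₁, D, v, l₂, j₂, o₁, o₂, rfl⟩ := o.exists_binder (i := i - k') (by omega)
    have o₃ := o₂.trans o'
    rw [Nat.add_sub_cancel' hi] at o₃
    exact key (hbr.bound _ _ _ _ _ _ o₁ _ _ _ _ o₃)

theorem solves_bang (h : PTm.Typing P t A C) (hs : φ.Solves C) (halt : t.Alternating)
    (hbr : PsTm.Bracketing (P.map φ.onBang) (φ.onTm t))
    (hb : PsTm.Bang (P.map φ.onBang) (φ.onTm t)) : φ.Solves (PTm.bang P t) := by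
  rintro κ ⟨l, k, j, Δ, t', u, c', D, B, C', o, h', hκ⟩
  obtain ⟨A₁, C₁, h₁, hC₁⟩ := h.of_occ o
  obtain ⟨c₂, D₂, B₂, C₂, h₂, ht', hu⟩ := hasTy_app h₁ (hs.mono hC₁)
  rw [bool_eq_of_typing h₂ h'] at ht'
  by_cases hbt : φ.bool D.b = true
  swap
  · rcases hκ with ((⟨-, rfl⟩ | ⟨-, _, _, _, _, _, _, -, -, -, rfl⟩) |
      ⟨_, _, _, _, _, -, -, -, rfl⟩) | ⟨_, _, _, _, _, -, -, rfl⟩ <;> simp [Constr.Sat, hbt]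
  rw [hbt] at ht'
  have hbc := hb _ _ _ _ _ _ _ _ (occ_onTm o) ht'
  have hbu : (φ.onBang D₂).bang = true := by
    rw [onBang_bang, bool_eq_of_typing h₂ h', hbt]
  rw [DTy.circ, if_pos hbu] at hu
  obtain ⟨⟨m, w, rfl⟩, hwa⟩ := (o.alternating halt).2
  have hw : ¬ w.IsDoor := hwa.1
  have hm : 0 ≤ φ.int m := by
    by_contra hm
    obtain ⟨n, hn⟩ : ∃ n, (-φ.int m).toNat = n + 1 := ⟨(-φ.int m).toNat - 1, by omega⟩
    refine hbc.noClosing (doors .cls n (φ.onTm w)) ?_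
    rw [onTm, secPow, if_neg hm, hn, doors]
  have hm₀ : φ.int m = 0 → ∃ i, w = .var i := by
    intro h0
    have e : φ.onTm (.door m w) = φ.onTm w := by
      rw [onTm, h0]
      rfl
    rw [e] at hu hbc
    obtain ⟨i, hi⟩ := exists_eq_var_of_bangCond hbc (not_isDoor_onTm hw) hu
    exact ⟨i, onTm_eq_var hw hi.symm⟩
  -- The bang condition on the instance, read off at the occurrences that are not doors.
  have inner : ∀ {l k j Δ' v}, Occ PBang.up Δ (.door m w) l k j Δ' v → ¬ v.IsDoor →
      (¬ ∃ i, k ≤ i ∧ v = .var i) → 1 ≤ φ.eval (l : Multiset ℕ) := by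
    intro l k j Δ' v o' hv hfree
    have hne : φ.onTm v ≠ φ.onTm (.door m w) := by
      intro e
      have hnd := not_isDoor_onTm (φ := φ) hv
      rw [e, onTm, secPow_eq] at hnd
      have h0 : (φ.int m).natAbs = 0 := by
        by_contra h0
        exact hnd (isDoor_doors (by omega) _)
      obtain ⟨i, rfl⟩ := hm₀ (by omega)
      cases o' with
      | refl => exact hv ⟨_, _, rfl⟩
      | door o' =>
        cases o' with
        | refl => exact hfree ⟨i, Nat.zero_le _, rfl⟩
    have := hbc.inside _ _ _ _ _ (occ_onTm o') hne (by
      rintro ⟨i, hi, e⟩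
      exact hfree ⟨i, hi, onTm_eq_var hv e.symm⟩)
    rwa [s_expand] at this
  rcases hκ with ((⟨hf, rfl⟩ | ⟨-, l', k', j', Δ', i, E, o', hi, hE, rfl⟩) |
      ⟨l', k', j', Δ', v, o', hv, hfree, rfl⟩) | ⟨l', k', j', Δ', i, o', hi, rfl⟩
  · have := hbc.one
    rw [freeOcc_onTm] at this
    omega
  · intro _
    obtain ⟨E', hE', hb'⟩ := hbc.bangVar _ _ _ _ _ (occ_onTm o') hi
    rw [List.getElem?_map, hE] at hE'
    obtain rfl := Option.some.inj hE'
    rwa [onBang_bang] at hb'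
  · intro _
    by_cases hvd : v.IsDoor
    · -- A door has the same word as its parent, to which `inner` applies.
      rcases o'.parent with ⟨rfl, -⟩ | ⟨l₁, k₁, j₁, Δ₁, p, op, hp, hl⟩
      · exact absurd rfl hv
      · rcases hl with ⟨hpd, rfl⟩ | ⟨d, rfl, -⟩
        · exact inner op hpd (by rintro ⟨i, -, e⟩; exact hp i e)
        · exact absurd hvd (op.alternating (⟨hwa.1, hwa.2⟩ : (Tm.door m w).Alternating)).1
    · exact inner o' hvd hfree
  · intro _
    have q := occ_onTm (φ := φ) o'
    have h₁ := hbc.s_nonneg q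
    have h₂ := s_nonpos_of_bracketing hbr ((occ_onTm o).trans (.app_right (.refl _ _))) q
      hi
    rw [s_expand] at h₁ h₂
    omega

theorem bang_of_solves (h : PTm.Typing P t A C) (hs : φ.Solves C) (halt : t.Alternating)
    (hb : φ.Solves (PTm.bang P t)) : PsTm.Bang (P.map φ.onBang) (φ.onTm t) := by
  intro l k j Δ t' u X Y o hX
  obtain ⟨Δ, l, t', u, rfl, rfl, rfl, rfl, q⟩ := occ_app o
  obtain ⟨A₁, C₁, h₁, hC₁⟩ := h.of_occ q
  obtain ⟨c, D, B, C₂, h₂, ht', -⟩ := hasTy_app h₁ (hs.mono hC₁)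
  have hbt : φ.bool D.b = true := (LTy.lolli.inj (ht'.unique hX)).1
  have hbc : φ.Solves (PTm.bangCond Δ u D.b) :=
    fun κ hκ => hb κ ⟨_, _, _, _, _, _, _, _, _, _, q, h₂, hκ⟩
  have hone : u.freeOcc 0 ≤ 1 := by
    by_contra hf
    have := hbc (.boolZero D.b) (.inl (.inl (.inl ⟨by omega, rfl⟩)))
    simp [Constr.Sat, hbt] at this
  have hpos : ∀ {l k j Δ' v}, Occ PBang.up Δ u l k j Δ' v → v ≠ u →
      (¬ ∃ i, k ≤ i ∧ v = .var i) → 1 ≤ φ.eval (l : Multiset ℕ) :=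
    fun o' hv hfree => hbc _ (.inl (.inr ⟨_, _, _, _, _, o', hv, hfree, rfl⟩)) hbt
  have hzero : ∀ {l k j Δ' i}, Occ PBang.up Δ u l k j Δ' (.var i) → k ≤ i →
      φ.eval (l : Multiset ℕ) = 0 :=
    fun o' hi => hbc _ (.inr ⟨_, _, _, _, _, o', hi, rfl⟩) hbt
  obtain ⟨⟨m, w, rfl⟩, hwa⟩ := (q.alternating halt).2
  have hw : ¬ w.IsDoor := hwa.1
  have hm : φ.int m = 0 ∨ 1 ≤ φ.int m := by
    have ow : Occ PBang.up Δ (.door m w) [m] 0 0 Δ w := .door (.refl _ _)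
    by_cases hv : ∃ i, w = .var i
    · obtain ⟨i, rfl⟩ := hv
      have := hzero ow (Nat.zero_le i)
      left
      simpa using this
    · have := hpos ow (fun e => hw ⟨_, _, e⟩) (by rintro ⟨i, -, hi⟩; exact hv ⟨i, hi⟩)
      right
      simpa using this
  refine ⟨by rwa [freeOcc_onTm], fun l' k' j' Δ' i o' hi => ?_, fun w' e => ?_,
    fun l' k' j' Δ' v o' hv hfree => ?_⟩
  · obtain ⟨Δ', l', rfl, rfl, q'⟩ := occ_var o'
    have hf := Tm.freeOcc_pos_of_occ (n := 0) q' (by omega)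
    obtain ⟨_, _, hi', _⟩ := h₁.of_occ ((Occ.app_right (.refl _ _)).trans q')
    cases hi' with
    | @var _ _ E hE =>
      refine ⟨φ.onBang E, by simp [hE], ?_⟩
      rw [onBang_bang]
      exact hbc _ (.inl (.inl (.inr
        ⟨by omega, _, _, _, _, _, E, q', hi, hE, rfl⟩))) hbt
  · rw [onTm, secPow, if_pos (by omega)] at e
    cases hn : (φ.int m).toNat with
    | zero =>
      rw [hn] at e
      exact not_isDoor_onTm hw ⟨_, _, e⟩
    | succ n =>
      rw [hn] at e
      cases e
  · obtain ⟨Δ', rfl, ho⟩ := exists_origin o'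
    cases ho with
    | @node l₀ v₀ q' hv₀ =>
      rw [s_expand]
      refine hpos q' (by rintro rfl; exact hv₀ ⟨_, _, rfl⟩) ?_
      rintro ⟨i, hi, rfl⟩
      exact hfree ⟨i, hi, rfl⟩
    | @door l₀ m' w' a q' ha =>
      rw [s_append, s_expand, s_replicate, s_doorKind]
      by_cases e : (Tm.door m' w' : PTm) = .door m w
      · cases e
        obtain rfl := q'.eq_nil_of_self
        have ha₀ : a ≠ 0 := by
          rintro rfl
          exact hv (by rw [onTm, secPow_eq, Nat.sub_zero])
        rw [if_pos (by omega)]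
        simp only [Multiset.coe_nil, eval_zero]
        omega
      · have h₃ := hpos q' e (by rintro ⟨i, -, e⟩; cases e)
        -- The height at the end of the block of doors is nonnegative.
        have h₄ : 0 ≤ φ.eval (l₀ : Multiset ℕ) + φ.int m' := by
          rw [← eval_append_singleton]
          have ow := q'.trans (.door (.refl _ _))
          by_cases hfv : ∃ i, 0 + k' ≤ i ∧ w' = .var i
          · obtain ⟨i, hi, rfl⟩ := hfv
            exact (hzero ow hi).ge
          · refine (zero_le_one.trans (hpos ow ?_ hfv))
            rintro rfl
            have := ow.eq_nil_of_self
            simp at this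
        split <;> omega

/-! ### The correctness of the constraints -/

theorem wellStructured_iff (h : PTm.Typing P t A C) (halt : t.Alternating) :
    (φ.Admissible P t ∧ PsTm.WellStructured (P.map φ.onBang) (φ.onTm t)) ↔
      φ.Solves (PTm.const P t) := by
  simp only [PTm.const, solves_union]
  constructor
  · rintro ⟨ha, hw⟩
    have hl := solves_ltype h ha hw.localTyping
    have hs := solves_of_solves_ltype h hl
    exact ⟨⟨⟨hl, bracketing_iff.1 hw.bracketing⟩,
      solves_bang h hs halt hw.bracketing hw.bang⟩, (scope_iff h hs).1 hw.scope⟩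
  · rintro ⟨⟨⟨hl, hbr⟩, hb⟩, hsc⟩
    have hs := solves_of_solves_ltype h hl
    exact ⟨h.admissible hs, regular_onTm halt, localTyping_of_solves h hl,
      bracketing_iff.2 hbr, bang_of_solves h hs halt hb, (scope_iff h hs).2 hsc⟩

end Inst

/-! ### Counting -/

/-- The set `S` has at most `n` elements. -/
def CardLE {α : Type*} (S : Set α) (n : ℕ) : Prop := S.encard ≤ n

namespace CardLE

variable {α β ι : Type*} {S T : Set α} {m n : ℕ}

theorem mono (h : CardLE T n) (hS : S ⊆ T) (hn : n ≤ m) : CardLE S m :=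
  (Set.encard_le_encard hS).trans (h.trans (by exact_mod_cast hn))

theorem union (h : CardLE S m) (h' : CardLE T n) : CardLE (S ∪ T) (m + n) := by
  refine (Set.encard_union_le S T).trans ?_
  push_cast
  exact add_le_add h h'

theorem empty : CardLE (∅ : Set α) 0 := by simp [CardLE]

theorem singleton (a : α) : CardLE {a} 1 := by simp [CardLE]

theorem pair (a b : α) : CardLE {a, b} 2 := (singleton a).union (singleton b)

theorem image (h : CardLE S n) (f : α → β) : CardLE (f '' S) n :=
  (Set.encard_image_le f S).trans h

theorem image2 {T : Set ι} (h : CardLE S m) (h' : CardLE T n) (f : α → ι → β) :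
    CardLE (Set.image2 f S T) (m * n) := by
  rw [← Set.image_prod]
  refine (Set.encard_image_le _ _).trans ?_
  rw [Set.encard_prod]
  push_cast
  exact mul_le_mul' h h'

theorem biUnion {I : Set ι} {f : ι → Set α} (h : CardLE I m) (h' : ∀ i ∈ I, CardLE (f i) n) :
    CardLE (⋃ i ∈ I, f i) (m * n) := by
  have hI : I.Finite := Set.finite_of_encard_le_coe h
  have hm : hI.toFinset.card ≤ m := by
    have := h
    rw [CardLE, hI.encard_eq_coe_toFinset_card] at this
    exact_mod_cast this
  have e : (⋃ i ∈ I, f i) = ⋃ i ∈ hI.toFinset, f i := by simp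
  rw [CardLE, e]
  refine (Finset.set_encard_biUnion_le _ _).trans ?_
  refine (Finset.sum_le_card_nsmul _ _ (n : ℕ∞) fun i hi => h' i (by simpa using hi)).trans ?_
  rw [nsmul_eq_mul]
  push_cast
  gcongr

end CardLE

/-! ### The places of a p-type -/

/-- Extend an environment by a value for the variable `0`. -/
def extendEnv (x : Lin) (ρ : ℕ → Lin) : ℕ → Lin
  | 0 => x
  | n + 1 => ρ n

namespace PF

/-- What `F` adds to the combination at its root: the value of the environment if `F` is a
variable, and nothing otherwise. -/
def head (ρ : ℕ → Lin) : PF → Lin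
  | var i => ρ i
  | arr _ _ _ _ _ => 0
  | all _ _ => 0

/-- The linear combinations at the places inside `F`, relative to an environment `ρ`: `ρ i` is the
combination that a p-type to be substituted for the variable `i` adds at its root. All
quantifiers are inert: the variables bound by them add nothing. -/
def places : (ℕ → Lin) → PF → Set Lin
  | _, var _ => ∅
  | ρ, arr _ c F c' F' =>
      {c + F.head ρ} ∪ F.places ρ ∪ ({c' + F'.head ρ} ∪ F'.places ρ)
  | ρ, all c F => {c + F.head (extendEnv 0 ρ)} ∪ F.places (extendEnv 0 ρ)

/-- The linear combinations at the places inside `F`, relative to `ρ` and to a second environment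
`δ` that gives the values `δ 0`, `δ 1`, … to the variables bound by the quantifiers on the
spine of `F`, the path that goes to the right below arrows. Only these quantifiers
may be instantiated later on, when `F` occurs in an output type; the others are inert. A bound on
the number of combinations that holds for all `ρ` and `δ` is stable under instantiation. -/
def spine : (ℕ → Lin) → (ℕ → Lin) → PF → Set Lin
  | _, _, var _ => ∅
  | ρ, δ, arr _ c F c' F' =>
      {c + F.head ρ} ∪ F.places ρ ∪ ({c' + F'.head ρ} ∪ F'.spine ρ δ)
  | ρ, δ, all c F =>
      {c + F.head (extendEnv (δ 0) ρ)} ∪ F.spine (extendEnv (δ 0) ρ) fun n => δ (n + 1)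

theorem extendEnv_upRen (x : Lin) (ρ : ℕ → Lin) (r : ℕ → ℕ) :
    (fun i => extendEnv x ρ (upRen r i)) = extendEnv x fun i => ρ (r i) := by
  funext i
  cases i <;> rfl

theorem extendEnv_zero : extendEnv 0 0 = 0 := by
  funext i
  cases i <;> rfl

theorem head_rename (ρ : ℕ → Lin) (r : ℕ → ℕ) (F : PF) :
    (F.rename r).head ρ = F.head fun i => ρ (r i) := by
  cases F <;> rfl

theorem places_rename (ρ : ℕ → Lin) (r : ℕ → ℕ) (F : PF) :
    (F.rename r).places ρ = F.places fun i => ρ (r i) := by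
  induction F generalizing ρ r with
  | var i => rfl
  | arr b c F c' F' ih ih' => simp only [rename, places, head_rename, ih, ih']
  | all c F ih => simp only [rename, places, head_rename, ih, extendEnv_upRen]

theorem spine_rename (ρ δ : ℕ → Lin) (r : ℕ → ℕ) (F : PF) :
    (F.rename r).spine ρ δ = F.spine (fun i => ρ (r i)) δ := by
  induction F generalizing ρ δ r with
  | var i => rfl
  | arr b c F c' F' ih ih' =>
    simp only [rename, spine, head_rename, places_rename, ih']
  | all c F ih => simp only [rename, spine, head_rename, ih, extendEnv_upRen]

theorem head_zero (F : PF) : F.head 0 = 0 := by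
  cases F <;> rfl

/-- The environment seen by `F` when `σ` is substituted in it. -/
def substEnv (σ : ℕ → PLin) (ρ : ℕ → Lin) (i : ℕ) : Lin := (σ i).c + (σ i).F.head ρ

theorem substEnv_upSub (σ : ℕ → PLin) (x : Lin) (ρ : ℕ → Lin) :
    substEnv (upSub σ) (extendEnv x ρ) = extendEnv x (substEnv σ ρ) := by
  funext i
  cases i with
  | zero => simp [substEnv, upSub, head, extendEnv]
  | succ i =>
    simp only [substEnv, upSub, up, head_rename]
    rfl

theorem head_subst (σ : ℕ → PLin) (ρ : ℕ → Lin) (F : PF) :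
    (F.subst σ).c + (F.subst σ).F.head ρ = F.head (substEnv σ ρ) := by
  cases F with
  | var i => rfl
  | arr => simp [subst, head]
  | all => simp [subst, head]

theorem iUnion_places_upSub (σ : ℕ → PLin) (x : Lin) (ρ : ℕ → Lin) :
    (⋃ i, (upSub σ i).F.places (extendEnv x ρ)) ⊆ ⋃ i, (σ i).F.places ρ := by
  refine Set.iUnion_subset fun i => ?_
  cases i with
  | zero => exact Set.empty_subset _
  | succ i =>
    rw [upSub, up, places_rename]
    exact Set.subset_iUnion (fun i => (σ i).F.places ρ) i

theorem places_subst (σ : ℕ → PLin) (ρ : ℕ → Lin) (F : PF) :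
    (F.subst σ).F.places ρ ⊆ F.places (substEnv σ ρ) ∪ ⋃ i, (σ i).F.places ρ := by
  induction F generalizing σ ρ with
  | var i => exact (Set.subset_iUnion (fun i => (σ i).F.places ρ) i).trans Set.subset_union_right
  | arr b c F c' F' ih ih' =>
    simp only [subst, places, add_assoc, head_subst]
    have h := ih σ ρ
    have h' := ih' σ ρ
    intro x hx
    rcases hx with (hx | hx) | (hx | hx)
    · exact .inl (.inl (.inl hx))
    · exact (h hx).imp (fun h => .inl (.inr h)) id
    · exact .inl (.inr (.inl hx))
    · exact (h' hx).imp (fun h => .inr (.inr h)) id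
  | all c F ih =>
    simp only [subst, places, add_assoc, head_subst, substEnv_upSub]
    have h := ih (upSub σ) (extendEnv 0 ρ)
    rw [substEnv_upSub] at h
    intro x hx
    rcases hx with hx | hx
    · exact .inl (.inl hx)
    · exact (h hx).imp .inr fun h => iUnion_places_upSub _ _ _ h

/-- A substituted p-type contributes its spine only once, at the end of the
spine of `F`; in its other copies all quantifiers are inert. -/
theorem spine_subst (σ : ℕ → PLin) (ρ δ : ℕ → Lin) (F : PF) :
    ∃ i δ', (F.subst σ).F.spine ρ δ ⊆
      F.spine (substEnv σ ρ) δ ∪ (⋃ i, (σ i).F.places ρ) ∪ (σ i).F.spine ρ δ' := by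
  induction F generalizing σ ρ δ with
  | var i => exact ⟨i, δ, Set.subset_union_right⟩
  | arr b c F c' F' ih ih' =>
    obtain ⟨i, δ', h'⟩ := ih' σ ρ δ
    refine ⟨i, δ', ?_⟩
    have h := places_subst σ ρ F
    simp only [subst, spine, add_assoc, head_subst]
    intro x hx
    rcases hx with (hx | hx) | (hx | hx)
    · exact .inl (.inl (.inl (.inl hx)))
    · exact .inl ((h hx).imp (fun h => .inl (.inr h)) id)
    · exact .inl (.inl (.inr (.inl hx)))
    · exact (h' hx).imp (fun h => h.imp (fun h => .inr (.inr h)) id) id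
  | all c F ih =>
    obtain ⟨i, δ', h⟩ := ih (upSub σ) (extendEnv (δ 0) ρ) fun n => δ (n + 1)
    have hσ : ∃ n, (upSub σ i).F.spine (extendEnv (δ 0) ρ) δ' ⊆ (σ n).F.spine ρ δ' := by
      cases i with
      | zero => exact ⟨0, Set.empty_subset _⟩
      | succ i =>
        refine ⟨i, ?_⟩
        rw [upSub, up, spine_rename]
        rfl
    obtain ⟨n, hn⟩ := hσ
    refine ⟨n, δ', ?_⟩
    rw [substEnv_upSub] at h
    simp only [subst, spine, add_assoc, head_subst, substEnv_upSub]
    intro x hx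
    rcases hx with hx | hx
    · exact .inl (.inl (.inl hx))
    · rcases h hx with (h | h) | h
      · exact .inl (.inl (.inr h))
      · exact .inl (.inr (iUnion_places_upSub _ _ _ h))
      · exact .inr (hn h)

theorem places_subset_spine (F : PF) : F.places 0 ⊆ F.spine 0 0 := by
  induction F with
  | var i => exact subset_rfl
  | arr b c F c' F' _ ih' =>
    exact Set.union_subset_union_right _ (Set.union_subset_union_right _ ih')
  | all c F ih =>
    rw [places, spine]
    simp only [Pi.zero_apply, extendEnv_zero]
    exact Set.union_subset_union_right _ ih

theorem cardLE_root_places (c : Lin) (ρ : ℕ → Lin) (F : PF) :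
    CardLE ({c + F.head ρ} ∪ F.places ρ) F.erase.size := by
  induction F generalizing c ρ with
  | var i => exact ((CardLE.singleton _).union CardLE.empty).mono subset_rfl le_rfl
  | arr b d F d' F' ih ih' =>
    refine ((CardLE.singleton _).union ((ih d ρ).union (ih' d' ρ))).mono subset_rfl ?_
    simp only [erase, Ty.size]
    omega
  | all d F ih =>
    refine ((CardLE.singleton _).union (ih d _)).mono subset_rfl ?_
    simp only [erase, Ty.size]
    omega

theorem cardLE_root_spine (c : Lin) (ρ δ : ℕ → Lin) (F : PF) :
    CardLE ({c + F.head ρ} ∪ F.spine ρ δ) F.erase.size := by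
  induction F generalizing c ρ δ with
  | var i => exact ((CardLE.singleton _).union CardLE.empty).mono subset_rfl le_rfl
  | arr b d F d' F' _ ih' =>
    refine ((CardLE.singleton _).union
      ((cardLE_root_places d ρ F).union (ih' d' ρ δ))).mono subset_rfl ?_
    simp only [erase, Ty.size]
    omega
  | all d F ih =>
    refine ((CardLE.singleton _).union (ih d _ _)).mono subset_rfl ?_
    simp only [erase, Ty.size]
    omega

theorem bparams_rename (r : ℕ → ℕ) (F : PF) : (F.rename r).bparams = F.bparams := by
  induction F generalizing r with
  | var i => rfl
  | arr b c F c' F' ih ih' => simp only [rename, bparams, ih, ih']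
  | all c F ih => simp only [rename, bparams, ih]

theorem mem_bparams_subst {σ : ℕ → PLin} {F : PF} {b : ℕ} (h : b ∈ (F.subst σ).F.bparams) :
    b ∈ F.bparams ∨ ∃ i, b ∈ (σ i).F.bparams := by
  induction F generalizing σ with
  | var i => exact .inr ⟨i, h⟩
  | arr b' c F c' F' ih ih' =>
    simp only [subst, bparams, Multiset.mem_add] at h ⊢
    rcases h with (h | h) | h
    · exact .inl (.inl (.inl h))
    · exact (ih h).imp (fun h => .inl (.inr h)) id
    · exact (ih' h).imp .inr id
  | all c F ih =>
    refine (ih (σ := upSub σ) h).imp id ?_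
    rintro ⟨_ | i, hi⟩
    · simp [upSub, bparams] at hi
    · exact ⟨i, by simpa [upSub, up, bparams_rename] using hi⟩

theorem cardLE_bparams (F : PF) : CardLE {b | b ∈ F.bparams} F.erase.size := by
  induction F with
  | var i => exact CardLE.empty.mono (by simp [bparams]) (Nat.zero_le _)
  | arr b c F c' F' ih ih' =>
    refine (((CardLE.singleton b).union ih).union ih').mono (T := {b} ∪ _ ∪ _) ?_ ?_
    · intro x hx
      simpa [bparams, or_assoc] using hx
    · simp only [erase, Ty.size]
      omega
  | all c F ih => exact ih.mono subset_rfl (Nat.le_succ _)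

end PF

namespace PLin

/-- The linear combinations at the root of `A` and at the places inside it. -/
def places (ρ δ : ℕ → Lin) (A : PLin) : Set Lin := {A.c + A.F.head ρ} ∪ A.F.spine ρ δ

theorem places_inst (ρ δ : ℕ → Lin) (A B : PLin) (c : Lin) : ∃ δ₁ δ₂, (B.inst A).places ρ δ ⊆
    places ρ δ₁ ⟨c, .all B.c B.F⟩ ∪ A.F.places ρ ∪ A.places ρ δ₂ := by
  obtain ⟨i, δ₂, h⟩ := PF.spine_subst A.single ρ δ B.F
  have hi : (A.single i).F.spine ρ δ₂ ⊆ A.places ρ δ₂ := by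
    cases i with
    | zero => exact Set.subset_union_right
    | succ i => exact Set.empty_subset _
  have hU : (⋃ i, (A.single i).F.places ρ) ⊆ A.F.places ρ := by
    refine Set.iUnion_subset fun i => ?_
    cases i with
    | zero => exact subset_rfl
    | succ i => exact Set.empty_subset _
  have hE : PF.substEnv A.single ρ = extendEnv (A.c + A.F.head ρ) ρ := by
    funext i
    cases i with
    | zero => rfl
    | succ i => simp [PF.substEnv, single, PF.head, extendEnv]
  rw [hE] at h
  refine ⟨extendEnv (A.c + A.F.head ρ) δ, δ₂, ?_⟩
  rw [inst_eq, places]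
  simp only [add_assoc, PF.head_subst, hE]
  intro x hx
  rcases hx with hx | hx
  · exact .inl (.inl (.inr (.inl hx)))
  · rcases h hx with (h | h) | h
    · exact .inl (.inl (.inr (.inr h)))
    · exact .inl (.inr (hU h))
    · exact .inr (hi h)

end PLin

/-! ### The number of constraints -/

theorem cardLE_admF (F : PF) : CardLE (admF F) (3 * F.erase.size) := by
  induction F with
  | var i => exact CardLE.empty.mono subset_rfl (Nat.zero_le _)
  | arr b c F c' F' ih ih' =>
    refine (((CardLE.pair _ _).union ih).union ((CardLE.singleton _).union ih')).mono
      subset_rfl ?_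
    simp only [PF.erase, Ty.size]
    omega
  | all c F ih =>
    refine ((CardLE.singleton _).union ih).mono subset_rfl ?_
    simp only [PF.erase, Ty.size]
    omega

theorem cardLE_admBang (D : PBang) : CardLE (admBang D) (3 * D.F.erase.size + 2) :=
  ((CardLE.pair _ _).union (cardLE_admF _)).mono subset_rfl (by omega)

theorem cardLE_admLin (A : PLin) : CardLE (admLin A) (3 * A.F.erase.size + 1) :=
  ((CardLE.singleton _).union (cardLE_admF _)).mono subset_rfl (by omega)

theorem unifF_subset (F F' : PF) : unifF F F' ⊆
    Set.image2 Constr.linEq (F.places 0) (F'.places 0) ∪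
    Set.image2 Constr.boolEq {b | b ∈ F.bparams} {b | b ∈ F'.bparams} := by
  induction F generalizing F' with
  | var i => cases F' <;> exact Set.empty_subset _
  | arr b c F d G ih ih' =>
    cases F' with
    | var => exact Set.empty_subset _
    | all => exact Set.empty_subset _
    | arr b₁ c₁ F₁ d₁ G₁ =>
      have hF : ∀ x ∈ F.places 0, x ∈ (PF.arr b c F d G).places 0 := fun x hx => .inl (.inr hx)
      have hG : ∀ x ∈ G.places 0, x ∈ (PF.arr b c F d G).places 0 := fun x hx => .inr (.inr hx)
      have hF₁ : ∀ x ∈ F₁.places 0, x ∈ (PF.arr b₁ c₁ F₁ d₁ G₁).places 0 :=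
        fun x hx => .inl (.inr hx)
      have hG₁ : ∀ x ∈ G₁.places 0, x ∈ (PF.arr b₁ c₁ F₁ d₁ G₁).places 0 :=
        fun x hx => .inr (.inr hx)
      rintro κ ((( rfl | rfl) | h) | (rfl | h))
      · exact .inr ⟨b, by simp [PF.bparams], b₁, by simp [PF.bparams], rfl⟩
      · exact .inl ⟨c, .inl (.inl (by simp [PF.head_zero])),
          c₁, .inl (.inl (by simp [PF.head_zero])), rfl⟩
      · rcases ih _ h with ⟨x, hx, y, hy, rfl⟩ | ⟨x, hx, y, hy, rfl⟩
        · exact .inl ⟨x, hF x hx, y, hF₁ y hy, rfl⟩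
        · exact .inr ⟨x, by simp_all [PF.bparams], y, by simp_all [PF.bparams], rfl⟩
      · exact .inl ⟨d, .inr (.inl (by simp [PF.head_zero])),
          d₁, .inr (.inl (by simp [PF.head_zero])), rfl⟩
      · rcases ih' _ h with ⟨x, hx, y, hy, rfl⟩ | ⟨x, hx, y, hy, rfl⟩
        · exact .inl ⟨x, hG x hx, y, hG₁ y hy, rfl⟩
        · exact .inr ⟨x, by simp_all [PF.bparams], y, by simp_all [PF.bparams], rfl⟩
  | all c F ih =>
    cases F' with
    | var => exact Set.empty_subset _
    | arr => exact Set.empty_subset _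
    | all c₁ F₁ =>
      rintro κ (rfl | h)
      · exact .inl ⟨c, .inl (by simp [PF.extendEnv_zero, PF.head_zero]),
          c₁, .inl (by simp [PF.extendEnv_zero, PF.head_zero]), rfl⟩
      · rcases ih _ h with ⟨x, hx, y, hy, rfl⟩ | ⟨x, hx, y, hy, rfl⟩
        · exact .inl ⟨x, .inr (by rwa [PF.extendEnv_zero]), y,
            .inr (by rwa [PF.extendEnv_zero]), rfl⟩
        · exact .inr ⟨x, hx, y, hy, rfl⟩

namespace PTm

/-- Number of nodes of a p-term, the nodes of the types being counted at the binders, at the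
type applications and at every occurrence of a variable. -/
def weight : List PBang → PTm → ℕ
  | P, .var i => 1 + (P[i]?.map fun D => D.F.erase.size).getD 0
  | P, .lam D t => weight (D :: P) t + D.F.erase.size + 1
  | P, .app t u => weight P t + weight P u + 1
  | P, .tlam t => weight (P.map PBang.up) t + 1
  | P, .tapp t A => weight P t + A.F.erase.size + 1
  | P, .door _ t => weight P t + 1

theorem nodes_le_weight (P : List PBang) (t : PTm) : t.nodes ≤ t.weight P := by
  induction t generalizing P with
  | var i => simp [Tm.nodes, weight]
  | lam D t ih => have := ih (D :: P); simp only [Tm.nodes, weight]; omega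
  | app t u ih ih' => have := ih P; have := ih' P; simp only [Tm.nodes, weight]; omega
  | tlam t ih => have := ih (P.map PBang.up); simp only [Tm.nodes, weight]; omega
  | tapp t A ih => have := ih P; simp only [Tm.nodes, weight]; omega
  | door m t ih => have := ih P; simp only [Tm.nodes, weight]; omega

end PTm

theorem Lifts.weight_le {M : FTm} {t : PTm} (h : Lifts M t) (P : List PBang) :
    t.weight P ≤ 2 * M.size (eraseCtx P) := by
  induction h generalizing P with
  | var m i =>
    have : (eraseCtx P)[i]?.map Ty.size = P[i]?.map fun D => D.F.erase.size := by
      simp [eraseCtx, Function.comp_def]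
    simp only [PTm.weight, FTm.size, this]
    omega
  | @lam m T D M t hD _ ih =>
    have := ih (D :: P)
    have e : eraseCtx (D :: P) = T :: eraseCtx P := by rw [← hD.1]; rfl
    rw [e] at this
    simp only [PTm.weight, FTm.size, hD.1]
    omega
  | app m _ _ ih ih' =>
    have := ih P
    have := ih' P
    simp only [PTm.weight, FTm.size]
    omega
  | tlam m _ ih =>
    have := ih (P.map PBang.up)
    rw [eraseCtx_up] at this
    simp only [PTm.weight, FTm.size]
    omega
  | tapp m hA _ ih =>
    have := ih P
    simp only [PTm.weight, FTm.size, hA.1]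
    omega

namespace PTm.Typing

variable {P Δ : List PBang} {t u : PTm} {A : PLin} {C : Set Constr}

/-- The number of distinct linear combinations in the output type is linear. -/
theorem cardLE_places (h : Typing P t A C) (ρ δ : ℕ → Lin) :
    CardLE (A.places ρ δ) (2 * t.weight P) := by
  induction h generalizing ρ δ with
  | @var P i D hi =>
    refine (PF.cardLE_root_spine D.c ρ δ D.F).mono subset_rfl ?_
    simp only [weight, hi, Option.map_some, Option.getD_some]
    omega
  | @door P m t A C _ ih =>
    refine ((CardLE.singleton ({m} + A.c + A.F.head ρ)).union (ih ρ δ)).mono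
      (Set.union_subset_union_right _ Set.subset_union_right) ?_
    simp only [weight]
    omega
  | @lam P D t A C _ ih =>
    refine ((CardLE.singleton 0).union
      ((PF.cardLE_root_places D.c ρ D.F).union (ih ρ δ))).mono ?_ ?_
    · rw [PLin.places, PF.head, add_zero]
      exact subset_rfl
    · simp only [weight]
      omega
  | @app P D t u c A B _ _ _ _ _ ih _ =>
    refine (ih ρ δ).mono (S := B.places ρ δ) ?_ ?_
    · exact Set.subset_union_right.trans Set.subset_union_right
    · simp only [weight]
      omega
  | @tlam P t A C _ ih =>
    refine ((CardLE.singleton 0).union (ih (extendEnv (δ 0) ρ) fun n => δ (n + 1))).mono ?_ ?_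
    · rw [PLin.places, PF.head, add_zero]
      exact subset_rfl
    · simp only [weight]
      omega
  | @tapp P t c A B C _ ih =>
    obtain ⟨δ₁, δ₂, h⟩ := PLin.places_inst ρ δ A B c
    refine (((ih ρ δ₁).union (((PF.cardLE_root_places A.c ρ A.F).mono
      Set.subset_union_right le_rfl))).union
      (PF.cardLE_root_spine A.c ρ δ₂ A.F)).mono h ?_
    simp only [weight]
    omega

theorem cardLE_bparams (h : Typing P t A C) : CardLE {b | b ∈ A.F.bparams} (t.weight P) := by
  induction h with
  | @var P i D hi =>
    refine (PF.cardLE_bparams D.F).mono subset_rfl ?_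
    simp only [weight, hi, Option.map_some, Option.getD_some]
    omega
  | door _ ih => exact ih.mono subset_rfl (Nat.le_succ _)
  | @lam P D t A C _ ih =>
    refine (((CardLE.singleton D.b).union (PF.cardLE_bparams D.F)).union ih).mono
      (T := {D.b} ∪ _ ∪ _) ?_ ?_
    · intro x hx
      simpa [PF.bparams, or_assoc] using hx
    · simp only [weight]
      omega
  | app _ _ _ ih _ =>
    refine ih.mono (fun x hx => ?_) (by simp only [weight]; omega)
    exact Multiset.mem_add.2 (.inr hx)
  | tlam _ ih => exact ih.mono subset_rfl (Nat.le_succ _)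
  | @tapp P t c A B C _ ih =>
    refine (ih.union (PF.cardLE_bparams A.F)).mono (fun b hb => ?_)
      (by simp only [weight]; omega)
    rcases PF.mem_bparams_subst (σ := A.single) (by simpa [PLin.inst_eq] using hb) with
      h | ⟨_ | i, hi⟩
    · exact .inl h
    · exact .inr hi
    · simp [PLin.single, PF.bparams] at hi

/-- At an application the unification constraints relate a place of the left to one of the right
side, so their number is bounded by the product of the weights; these products sum up to a
quadratic bound. -/
theorem cardLE_constr (h : Typing P t A C) : CardLE C (3 * t.weight P ^ 2) := by
  induction h with
  | @var P i D hi =>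
    refine (cardLE_admBang D).mono subset_rfl ?_
    simp only [weight, hi, Option.map_some, Option.getD_some]
    nlinarith
  | door _ ih =>
    refine (ih.union (CardLE.singleton _)).mono subset_rfl ?_
    simp only [weight]
    ring_nf
    omega
  | lam _ ih =>
    refine (ih.union (cardLE_admBang _)).mono subset_rfl ?_
    simp only [weight]
    ring_nf
    omega
  | @app P D t u c A B C₁ C₂ h₁ h₂ _ ih ih' =>
    have hl := (h₁.cardLE_places 0 0).mono (S := {D.c} ∪ D.F.places 0) (by
      intro x hx
      refine .inr (.inl (hx.imp ?_ id))
      rintro rfl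
      simp [PF.head_zero]) le_rfl
    have hr := (h₂.cardLE_places 0 0).mono (S := {A.c} ∪ A.F.places 0) (by
      intro x hx
      refine hx.imp ?_ fun h => PF.places_subset_spine _ h
      rintro rfl
      simp [PF.head_zero]) le_rfl
    have hb := h₁.cardLE_bparams.mono (S := {b | b ∈ D.F.bparams})
      (fun x hx => by
        have hx : x ∈ D.F.bparams := hx
        simp [PF.bparams, hx]) le_rfl
    have hu : unifLin D.circ A ⊆
        Set.image2 Constr.linEq ({D.c} ∪ D.F.places 0) ({A.c} ∪ A.F.places 0) ∪
        Set.image2 Constr.boolEq {b | b ∈ D.F.bparams} {b | b ∈ A.F.bparams} := by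
      refine Set.union_subset ?_ ((unifF_subset D.F A.F).trans (Set.union_subset_union_left _
        (Set.image2_subset Set.subset_union_right Set.subset_union_right)))
      rintro κ rfl
      exact .inl ⟨D.c, .inl rfl, A.c, .inl rfl, rfl⟩
    refine (((ih.union ih').union (CardLE.singleton _)).union
      (((hl.image2 hr _).union (hb.image2 h₂.cardLE_bparams _)).mono hu le_rfl)).mono
      subset_rfl ?_
    simp only [weight]
    nlinarith
  | tlam _ ih =>
    refine ih.mono subset_rfl ?_
    simp only [weight]
    ring_nf
    omega
  | tapp _ ih =>
    refine ((ih.union (CardLE.singleton _)).union (cardLE_admLin _)).mono subset_rfl ?_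
    simp only [weight]
    ring_nf
    omega

end PTm.Typing

section Occurrences

variable {β α δ : Type} (up : β → β)

/-- The set of the occurrences of subterms in `t`. -/
def occurrences (Γ : List β) (t : Tm β α δ) : Set (List δ × ℕ × ℕ × List β × Tm β α δ) :=
  {o | Occ up Γ t o.1 o.2.1 o.2.2.1 o.2.2.2.1 o.2.2.2.2}

theorem cardLE_occurrences (Γ : List β) (t : Tm β α δ) :
    CardLE (occurrences up Γ t) t.nodes := by
  induction t generalizing Γ with
  | var i =>
    refine (CardLE.singleton ([], 0, 0, Γ, .var i)).mono ?_ le_rfl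
    rintro ⟨l, k, j, Δ, u⟩ ho
    cases ho
    rfl
  | lam D t ih =>
    refine (((ih (D :: Γ)).image fun o => (o.1, o.2.1 + 1, o.2.2)).union
      (CardLE.singleton ([], 0, 0, Γ, .lam D t))).mono ?_ le_rfl
    rintro ⟨l, k, j, Δ, u⟩ ho
    cases ho with
    | refl => exact .inr rfl
    | @lam _ _ _ _ _ _ k _ o =>
      exact .inl ⟨(l, k, j, Δ, u), o, rfl⟩
  | app t u ih ih' =>
    refine (((ih Γ).union (ih' Γ)).union
      (CardLE.singleton ([], 0, 0, Γ, .app t u))).mono ?_ le_rfl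
    rintro ⟨l, k, j, Δ, u⟩ ho
    cases ho with
    | refl => exact .inr rfl
    | app_left o => exact .inl (.inl o)
    | app_right o => exact .inl (.inr o)
  | tlam t ih =>
    refine (((ih (Γ.map up)).image fun o => (o.1, o.2.1, o.2.2.1 + 1, o.2.2.2)).union
      (CardLE.singleton ([], 0, 0, Γ, .tlam t))).mono ?_ le_rfl
    rintro ⟨l, k, j, Δ, u⟩ ho
    cases ho with
    | refl => exact .inr rfl
    | @tlam _ _ _ _ _ _ j o =>
      exact .inl ⟨(l, k, j, Δ, u), o, rfl⟩
  | tapp t A ih =>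
    refine ((ih Γ).union (CardLE.singleton ([], 0, 0, Γ, .tapp t A))).mono ?_ le_rfl
    rintro ⟨l, k, j, Δ, u⟩ ho
    cases ho with
    | refl => exact .inr rfl
    | tapp o => exact .inl o
  | door d t ih =>
    refine (((ih Γ).image fun o => (d :: o.1, o.2)).union
      (CardLE.singleton ([], 0, 0, Γ, .door d t))).mono ?_ le_rfl
    rintro ⟨l, k, j, Δ, u⟩ ho
    cases ho with
    | refl => exact .inr rfl
    | door o => exact .inl ⟨(_, _, _, _, _), o, rfl⟩

/-- A set whose elements come from the occurrences of subterms in `t`, at most `n` from each. -/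
theorem cardLE_of_occurrences {γ : Type*} {Γ : List β} {t : Tm β α δ} {S : Set γ} {n : ℕ}
    (f : List δ → ℕ → ℕ → List β → Tm β α δ → Set γ)
    (hf : ∀ l k j Δ u, Occ up Γ t l k j Δ u → CardLE (f l k j Δ u) n)
    (hS : ∀ x ∈ S, ∃ l k j Δ u, Occ up Γ t l k j Δ u ∧ x ∈ f l k j Δ u) :
    CardLE S (t.nodes * n) := by
  refine ((cardLE_occurrences up Γ t).biUnion
    (f := fun o => f o.1 o.2.1 o.2.2.1 o.2.2.2.1 o.2.2.2.2)
    fun o ho => hf o.1 o.2.1 o.2.2.1 o.2.2.2.1 o.2.2.2.2 ho).mono (fun x hx => ?_) le_rfl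
  obtain ⟨l, k, j, Δ, u, o, hx⟩ := hS x hx
  exact Set.mem_biUnion (show (l, k, j, Δ, u) ∈ occurrences up Γ t from o) hx

theorem cardLE_words {γ : Type*} {Γ : List β} {t : Tm β α δ} {S : Set γ} (f : List δ → γ)
    (hS : ∀ x ∈ S, ∃ l k j Δ u, Occ up Γ t l k j Δ u ∧ x = f l) : CardLE S t.nodes := by
  rw [← mul_one t.nodes]
  exact cardLE_of_occurrences up (fun l _ _ _ _ => {f l}) (fun _ _ _ _ _ _ => .singleton _) hS

end Occurrences

namespace PTm

variable {P Δ : List PBang} {t u : PTm} {A : PLin} {C : Set Constr}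

/-- The prefixes of words of occurrences are words of occurrences, which
makes the number of bracketing constraints linear and not quadratic in `u`. -/
theorem cardLE_wbracket {S : Set Constr}
    (hS : ∀ κ ∈ S, ∃ l k j Δ' v, Occ PBang.up Δ u l k j Δ' v ∧ κ ∈ wbracket l) :
    CardLE S u.nodes := by
  refine cardLE_words PBang.up (Γ := Δ) (fun l => .linNonneg (l : Multiset ℕ)) fun κ hκ => ?_
  obtain ⟨l, k, j, Δ', v, o, l', hl', rfl⟩ := hS κ hκ
  obtain ⟨k', j', Δ'', v', o'⟩ := o.exists_of_prefix hl'
  exact ⟨_, _, _, _, _, o', rfl⟩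

theorem cardLE_bracket {S : Set Constr}
    (hS : ∀ κ ∈ S, ∃ l k j Δ' v, Occ PBang.up Δ u l k j Δ' v ∧ κ ∈ bracket l) :
    CardLE S (2 * u.nodes) := by
  refine ((cardLE_wbracket (Δ := Δ) (u := u) (S := {κ | ∃ l k j Δ' v,
    Occ PBang.up Δ u l k j Δ' v ∧ κ ∈ wbracket l}) fun κ hκ => hκ).union
    (cardLE_words PBang.up (Γ := Δ) (t := u) (S := {κ | ∃ l k j Δ' v,
      Occ PBang.up Δ u l k j Δ' v ∧ κ = Constr.linEq (l : Multiset ℕ) 0})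
      (fun l => Constr.linEq (l : Multiset ℕ) 0) fun κ hκ => hκ)).mono (fun κ hκ => ?_) (by omega)
  obtain ⟨l, k, j, Δ', v, o, h | h⟩ := hS κ hκ
  · exact .inl ⟨_, _, _, _, _, o, h⟩
  · exact .inr ⟨_, _, _, _, _, o, h⟩

theorem cardLE_ltype (h : Typing P t A C) :
    CardLE (ltype P t) (3 * t.weight P ^ 2 + t.nodes + t.nodes) := by
  refine (h.cardLE_constr.mono ?_ le_rfl).union ?_ |>.union ?_
  · rintro κ ⟨A', C', h', hκ⟩
    obtain ⟨-, rfl⟩ := h.unique h'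
    exact hκ
  · rw [← mul_one t.nodes]
    refine cardLE_of_occurrences PBang.up (Γ := P)
      (fun _ k _ _ u => {κ | ∃ i D, u = .var (i + k) ∧ P[i]? = some D ∧ κ = .boolOne D.b})
      (fun l k j Δ u o => ?_) ?_
    · by_cases hu : ∃ i D, u = .var (i + k) ∧ P[i]? = some D
      · obtain ⟨i, D, rfl, hD⟩ := hu
        refine (CardLE.singleton (.boolOne D.b)).mono ?_ le_rfl
        rintro κ ⟨i', D', hi, hD', rfl⟩
        obtain rfl : i = i' := by simpa using hi
        rw [hD] at hD'
        obtain rfl := Option.some.inj hD'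
        rfl
      · refine CardLE.empty.mono ?_ (Nat.zero_le _)
        rintro κ ⟨i', D', hi, hD', -⟩
        exact hu ⟨i', D', hi, hD'⟩
    · rintro κ ⟨i, D, hD, hi, rfl⟩
      obtain ⟨l, k, j, Δ, o⟩ := Tm.exists_count_pos (up := PBang.up) (by omega : 0 < t.count i) P
      exact ⟨_, _, _, _, _, o, i, D, rfl, hD, rfl⟩
  · rw [← mul_one t.nodes]
    refine cardLE_of_occurrences PBang.up (Γ := P)
      (fun _ _ _ _ u => {κ | ∃ D v, u = .lam D v ∧ κ = .boolOne D.b}) (fun l k j Δ u o => ?_) ?_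
    · by_cases hu : ∃ D v, u = .lam D v
      · obtain ⟨D, v, rfl⟩ := hu
        refine (CardLE.singleton (.boolOne D.b)).mono ?_ le_rfl
        rintro κ ⟨D', v', hu, rfl⟩
        cases hu
        rfl
      · refine CardLE.empty.mono ?_ (Nat.zero_le _)
        rintro κ ⟨D', v', hu', -⟩
        exact hu ⟨D', v', hu'⟩
    · rintro κ ⟨l, k, j, Δ, D, v, o, -, rfl⟩
      exact ⟨_, _, _, _, _, o, D, v, rfl, rfl⟩

theorem cardLE_bracketing (P : List PBang) (t : PTm) :
    CardLE (bracketing P t) (2 * t.nodes + t.nodes + t.nodes * (2 * t.nodes)) := by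
  refine (cardLE_bracket (Δ := P) ?_).union (cardLE_wbracket (Δ := P) ?_) |>.union ?_
  · rintro κ ⟨l, k, j, Δ, i, o, -, hκ⟩
    exact ⟨_, _, _, _, _, o, hκ⟩
  · rintro κ ⟨l, k, j, Δ, D, v, o, hκ⟩
    exact ⟨_, _, _, _, _, o, hκ⟩
  · refine cardLE_of_occurrences PBang.up (Γ := P)
      (fun _ _ _ Δ u => {κ | ∃ D v, u = .lam D v ∧ ∃ l k j Δ' w,
        Occ PBang.up (D :: Δ) v l k j Δ' w ∧ κ ∈ bracket l}) (fun l k j Δ u o => ?_) ?_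
    · by_cases hu : ∃ D v, u = .lam D v
      · obtain ⟨D, v, rfl⟩ := hu
        have := o.nodes_le
        simp only [Tm.nodes] at this
        refine (cardLE_bracket (Δ := D :: Δ) (u := v) ?_).mono subset_rfl (by omega)
        rintro κ ⟨D', v', hu, h⟩
        cases hu
        exact h
      · refine CardLE.empty.mono ?_ (Nat.zero_le _)
        rintro κ ⟨D', v', hu', -⟩
        exact hu ⟨D', v', hu'⟩
    · rintro κ ⟨l, k, j, Δ, D, v, o, l', k', j', Δ', o', hκ⟩
      exact ⟨_, _, _, _, _, o, D, v, rfl, _, _, _, _, _, o', hκ⟩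

theorem cardLE_bangCond (Δ : List PBang) (u : PTm) (b : ℕ) :
    CardLE (bangCond Δ u b) (1 + u.nodes + u.nodes + u.nodes) := by
  refine ((CardLE.singleton (.boolZero b)).mono ?_ le_rfl).union ?_ |>.union ?_ |>.union ?_
  · rintro κ ⟨-, rfl⟩
    rfl
  · rw [← mul_one u.nodes]
    refine cardLE_of_occurrences PBang.up (Γ := Δ)
      (fun _ _ _ Δ' v => {κ | ∃ i D, v = .var i ∧ Δ'[i]? = some D ∧ κ = .boolImp b D.b})
      (fun l k j Δ' v o => ?_) ?_
    · by_cases hv : ∃ i D, v = .var i ∧ Δ'[i]? = some D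
      · obtain ⟨i, D, rfl, hD⟩ := hv
        refine (CardLE.singleton (.boolImp b D.b)).mono ?_ le_rfl
        rintro κ ⟨i', D', hi, hD', rfl⟩
        cases hi
        rw [hD] at hD'
        obtain rfl := Option.some.inj hD'
        rfl
      · refine CardLE.empty.mono ?_ (Nat.zero_le _)
        rintro κ ⟨i', D', hi, hD', -⟩
        exact hv ⟨i', D', hi, hD'⟩
    · rintro κ ⟨-, l, k, j, Δ', i, D, o, -, hD, rfl⟩
      exact ⟨_, _, _, _, _, o, i, D, rfl, hD, rfl⟩
  · refine cardLE_words PBang.up (Γ := Δ) (fun l => .impPos b (l : Multiset ℕ)) ?_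
    rintro κ ⟨l, k, j, Δ', v, o, -, -, rfl⟩
    exact ⟨_, _, _, _, _, o, rfl⟩
  · refine cardLE_words PBang.up (Γ := Δ) (fun l => .impZero b (l : Multiset ℕ)) ?_
    rintro κ ⟨l, k, j, Δ', i, o, -, rfl⟩
    exact ⟨_, _, _, _, _, o, rfl⟩

theorem cardLE_bang (P : List PBang) (t : PTm) :
    CardLE (bang P t) (t.nodes * (1 + t.nodes + t.nodes + t.nodes)) := by
  refine cardLE_of_occurrences PBang.up (Γ := P)
    (fun _ _ _ Δ v => {κ | ∃ (t' u : PTm) (c' : Lin) (D : PBang) (B : PLin) (C : Set Constr),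
      v = .app t' u ∧ Typing Δ t' ⟨c', .arr D.b D.c D.F B.c B.F⟩ C ∧ κ ∈ bangCond Δ u D.b})
    (fun l k j Δ v o => ?_) ?_
  · by_cases hv : ∃ (t' u : PTm) (c' : Lin) (D : PBang) (B : PLin) (C : Set Constr),
      v = .app t' u ∧ Typing Δ t' ⟨c', .arr D.b D.c D.F B.c B.F⟩ C
    · obtain ⟨t', u, c', D, B, C, rfl, h⟩ := hv
      have := o.nodes_le
      simp only [Tm.nodes] at this
      refine (cardLE_bangCond Δ u D.b).mono ?_ (by omega)
      rintro κ ⟨t'', u', c'', D', B', C', e, h', hκ⟩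
      cases e
      rwa [Inst.bool_eq_of_typing h h']
    · refine CardLE.empty.mono ?_ (Nat.zero_le _)
      rintro κ ⟨t'', u', c'', D', B', C', e, h', -⟩
      exact hv ⟨t'', u', c'', D', B', C', e, h'⟩
  · rintro κ ⟨l, k, j, Δ, t', u, c', D, B, C, o, h, hκ⟩
    exact ⟨_, _, _, _, _, o, t', u, c', D, B, C, rfl, h, hκ⟩

theorem cardLE_scope (P : List PBang) (t : PTm) :
    CardLE (scope P t) (t.nodes * t.nodes) := by
  refine cardLE_of_occurrences PBang.up (Γ := P)
    (fun _ _ _ Δ v => {κ | ∃ u, v = .tlam u ∧ ∃ l k j Δ' w,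
      Occ PBang.up (Δ.map PBang.up) u l k j Δ' w ∧ κ ∈ wbracket l}) (fun l k j Δ v o => ?_) ?_
  · by_cases hv : ∃ u, v = .tlam u
    · obtain ⟨u, rfl⟩ := hv
      have := o.nodes_le
      simp only [Tm.nodes] at this
      refine (cardLE_wbracket (Δ := Δ.map PBang.up) (u := u) ?_).mono subset_rfl (by omega)
      rintro κ ⟨u', hu, h⟩
      cases hu
      exact h
    · refine CardLE.empty.mono ?_ (Nat.zero_le _)
      rintro κ ⟨u', hu', -⟩
      exact hv ⟨u', hu'⟩
  · rintro κ ⟨l, k, j, Δ, u, o, l', k', j', Δ', v, A, C, o', -, -, hκ⟩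
    exact ⟨_, _, _, _, _, o, u, rfl, _, _, _, _, _, o', hκ⟩

theorem cardLE_const (h : Typing P t A C) : CardLE (const P t) (15 * t.weight P ^ 2) := by
  refine ((((cardLE_ltype h).union (cardLE_bracketing P t)).union (cardLE_bang P t)).union
    (cardLE_scope P t)).mono subset_rfl ?_
  have h₁ := nodes_le_weight P t
  have h₂ : 1 ≤ t.nodes := by cases t <;> simp [Tm.nodes]
  nlinarith

end PTm

end DLAL

theorem mainTheorem4 :
    (∀ (Γ : List DLAL.Ty) (M : DLAL.FTm) (T : DLAL.Ty) (P : List DLAL.PBang) (t : DLAL.PTm)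
      (φ : DLAL.Inst),
      DLAL.FTm.HasTy Γ M T → DLAL.IsFreeDecoration Γ M P t →
      ((φ.Admissible P t ∧ DLAL.PsTm.WellStructured (P.map φ.onBang) (φ.onTm t)) ↔
        φ.Solves (DLAL.PTm.const P t))) ∧
    (∃ K : ℕ, ∀ (Γ : List DLAL.Ty) (M : DLAL.FTm) (T : DLAL.Ty) (P : List DLAL.PBang)
      (t : DLAL.PTm),
      DLAL.FTm.HasTy Γ M T → DLAL.IsFreeDecoration Γ M P t →
      (DLAL.PTm.const P t).encard ≤ ((K * M.size Γ ^ 2 : ℕ) : ℕ∞)) := by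
  constructor
  · intro Γ M T P t φ hM hd
    rw [← hd.eraseCtx_eq] at hM
    obtain ⟨A, C, h, -⟩ := hM.exists_typing hd.lifts
    exact DLAL.Inst.wellStructured_iff h hd.lifts.isDoor_alternating.2
  · refine ⟨60, fun Γ M T P t hM hd => ?_⟩
    rw [← hd.eraseCtx_eq] at hM ⊢
    obtain ⟨A, C, h, -⟩ := hM.exists_typing hd.lifts
    refine (DLAL.PTm.cardLE_const h).mono subset_rfl ?_
    have := hd.lifts.weight_le P
    nlinarith
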